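/- Let $p$ be a prime, $q=p^f$ with $f\ge 1$, and let $n=3m+r\ge 8$ with $r\in\{0,1,2\}$. Let $\mathbb F_{q^2}$ be the field with $q^2$ elements and $e_1,\dots,e_n$ the canonical basis of column vectors, on which matrices act on the left. If $q=2$, let $\omega\in\mathbb F_4$ be a primitive cube root of unity. If $q>2$, let $a\in\mathbb F_{q^2}$ and put $b=2a-a^{2q}$, $c=a^{q+1}-4$, $\gamma=a^3+a^{3q}-6a^{q+1}+8$; assume that $\mathbb F_{q^2}=\mathbb F_p[a^3]$, $c\ne0$ and $\gamma\neq 0$ if $p\ne 3$, and that $\mathbb F_{q^2}=\mathbb F_3[a]$ and $a^q+a^{q-1}+1=0$ if $p=3$. Let $x\in \mathrm{GL}_n(q^2)$ be the following matrix. On $\langle e_{n-3},e_{n-2},e_{n-1},e_n\rangle$ it acts as $$\begin{pmatrix}0&1&0&0\\1&0&0&0\\0&0&-1&a\\0&0&0&1\end{pmatrix}\ (q>2,\ p\neq3),\qquad \begin{pmatrix}0&1&0&0\\1&0&0&0\\0&0&0&1\\0&0&1&0\end{pmatrix}\ (p=3),\qquad \begin{pmatrix}1&1&\omega&0\\1&0&\omega&\omega\\\omega^2&\omega^2&0&1\\0&\omega^2&1&1\end{pmatrix}\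 (q=2).$$ It permutes $e_1,\dots,e_{n-4}$ as follows: it swaps $e_{3j+3+r}$ and $e_{3j+4+r}$ for $0\le j\le m-3$; if $r=1$ it swaps $e_1,e_2$; if $r=2$ it swaps $e_1,e_3$ and also $e_2,e_4$; if $q=2$ and $n\ne 8,11$ it swaps $e_{n-7},e_{n-4}$; it fixes the remaining ones. Let $y\in\mathrm{GL}_n(q^2)$ be the matrix that acts on $\langle e_1,\dots,e_{n-3}\rangle$ as the permutation $\prod_{j=0}^{m-2}(e_{3j+1+r},e_{3j+2+r},e_{3j+3+r})$ and on $\langle e_{n-2},e_{n-1},e_n\rangle$ as $$\begin{pmatrix}bc^{-1}&-a^q\gamma c^{-2}&2\gamma c^{-2}\\1&-bc^{-1}&-b^qc^{-1}\\0&1&0\end{pmatrix}\ (q>2,\ p\ne3),\qquad \begin{pmatrix}1&0&a\\-a^q&1&a\\0&0&1\end{pmatrix}\ (p=3),\qquad\begin{pmatrix}0&0&1\\1&0&0\\0&1&0\end{pmatrix}\ (q=2).$$ Let $H=\langle (-1)^n x,\,y\rangle$. Let $J=I_n$ if $q=2$; $J=\mathrm{diag}(I_{n-2},J_2)$ with $J_2=\begin{pmatrix}0&1\\1&0\end{pmatrix}$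 if $p=3$; and $J=\mathrm{diag}(c\,I_{n-2},J_2)$ with $J_2=\gamma c^{-1}\begin{pmatrix}2&-a^q\\-a&2\end{pmatrix}$ if $q>2$ and $p\ne 3$. For a square matrix $g$ over $\mathbb F_{q^2}$ let $g^\psi$ be the matrix of the $q$-th powers of its entries, and let $$\mathrm{SU}_n(q^2)=\{g\in \mathrm{GL}_n(q^2)\mid g^TJg^\psi=J,\ \det g=1\}.$$ For $1\le \ell\le n-4$ let $B_\ell=\{e_j\mid \ell\le j\le n\}$, and let $S_{B_\ell}$ be the group of all $g\in\mathrm{GL}_n(q^2)$ that fix $e_j$ for every $j<\ell$, leave $\langle B_\ell\rangle$ invariant, and act on $\langle B_\ell\rangle$ as a matrix of determinant $1$ which preserves, in the above sense, the restriction of $J$ to $B_\ell$ (that is, as $\mathrm{SU}_{n-\ell+1}(q^2)$). **Theorem.** If $H$ contains $S_{B_\ell}$ for some $\ell$ with $1\le\ell\leq n-4$, then $H=\mathrm{SU}_n(q^2)$. -/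

import Mathlib

open Matrix

namespace SUGen

section Groups

variable {K : Type*} [Field K] {ι : Type*} [Fintype ι] [DecidableEq ι]

/-- The special unitary group `{g ∈ GL | gᵀ J g^σ = J, det g = 1}` of the sesquilinear form with
Gram matrix `J`, where `g^σ` is `g` with the field endomorphism `σ` applied to every entry. -/
def specialUnitary (σ : K →+* K) (J : Matrix ι ι K) : Subgroup (GL ι K) where
  carrier := {g | (g : Matrix ι ι K)ᵀ * J * (g : Matrix ι ι K).map σ = J ∧
    (g : Matrix ι ι K).det = 1}
  one_mem' := by
    refine ⟨?_, by simp⟩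
    simp [Matrix.map_one]
  mul_mem' := by
    rintro g h ⟨hg, hg'⟩ ⟨hh, hh'⟩
    refine ⟨?_, by simp [hg', hh']⟩
    rw [Units.val_mul, Matrix.transpose_mul, Matrix.map_mul]
    calc _ = (h : Matrix ι ι K)ᵀ *
          ((g : Matrix ι ι K)ᵀ * J * (g : Matrix ι ι K).map σ) * (h : Matrix ι ι K).map σ := by
            simp only [Matrix.mul_assoc]
      _ = J := by rw [hg, hh]
  inv_mem' := by
    rintro g ⟨hg, hg'⟩
    have h1 : (g : Matrix ι ι K) * (↑g⁻¹ : Matrix ι ι K) = 1 := by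
      rw [← Units.val_mul, mul_inv_cancel, Units.val_one]
    have h2 : (↑g⁻¹ : Matrix ι ι K)ᵀ * (g : Matrix ι ι K)ᵀ = 1 := by
      rw [← Matrix.transpose_mul, h1, Matrix.transpose_one]
    have h3 : (g : Matrix ι ι K).map σ * (↑g⁻¹ : Matrix ι ι K).map σ = 1 := by
      rw [← Matrix.map_mul, h1, Matrix.map_one σ (map_zero σ) (map_one σ)]
    refine ⟨?_, ?_⟩
    · conv_lhs => rw [← hg]
      calc _ = ((↑g⁻¹ : Matrix ι ι K)ᵀ * (g : Matrix ι ι K)ᵀ) * J *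
            ((g : Matrix ι ι K).map σ * (↑g⁻¹ : Matrix ι ι K).map σ) := by
              simp only [Matrix.mul_assoc]
        _ = J := by rw [h2, h3, Matrix.one_mul, Matrix.mul_one]
    · have := congrArg Matrix.det h1
      rwa [Matrix.det_mul, hg', one_mul, Matrix.det_one] at this

/-- Extension of a matrix indexed by `B` to one indexed by `ι`: it acts as the given matrix on the
span of the basis vectors in `B` and as the identity on the span of the others. -/
def extendById (B : Finset ι) : Matrix {i // i ∈ B} {i // i ∈ B} K →* Matrix ι ι K where
  toFun h := Matrix.reindex (Equiv.sumCompl (· ∈ B)) (Equiv.sumCompl (· ∈ B))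
    (Matrix.fromBlocks h 0 0 1)
  map_one' := by simp [Matrix.fromBlocks_one]
  map_mul' g h := by
    simp [Matrix.submatrix_mul_equiv, Matrix.fromBlocks_multiply]

/-- The group `S_B`: it acts on the span of `B` as the special unitary group of the restriction of
`J` to `B`, and as the identity on the span of the remaining basis vectors. -/
def partialSU (σ : K →+* K) (J : Matrix ι ι K) (B : Finset ι) : Subgroup (GL ι K) :=
  (specialUnitary σ (J.submatrix (Subtype.val : {i // i ∈ B} → ι) Subtype.val)).map
    (Units.map (extendById B))

end Groups

/-- The block diagonal `n × n` matrix whose last diagonal block is the `k × k` matrix `T`, and whose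
first block has the entries `U i j`, for row and column labels `1 ≤ i, j ≤ n - k` (labels start
at `1`, so that the label of `i : Fin n` is `i + 1`). -/
def withTail {K : Type*} [Zero K] (n : ℕ) {k : ℕ} (U : ℕ → ℕ → K)
    (T : Matrix (Fin k) (Fin k) K) : Matrix (Fin n) (Fin n) K :=
  Matrix.of fun i j =>
    if hi : n - k ≤ i.val then
      if hj : n - k ≤ j.val then T ⟨i.val - (n - k), by omega⟩ ⟨j.val - (n - k), by omega⟩ else 0
    else
      if n - k ≤ j.val then 0 else U (i.val + 1) (j.val + 1)

/-- The permutation of the labels `1, …, n - 4` that describes the action of `x` on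
`e_1, …, e_{n-4}`. With `n = 3 m + r`: `x` swaps `e_1, e_2` if `r = 1`; it swaps `e_1, e_3` and
`e_2, e_4` if `r = 2`; it swaps `e_{n-7}, e_{n-4}` if `q = 2` and `n ≠ 8, 11`; it swaps
`e_{3 i + 3 + r}` and `e_{3 i + 4 + r}` for `0 ≤ i ≤ m - 3`; it fixes all the others. -/
def xPerm (n q j : ℕ) : ℕ :=
  if n % 3 = 1 ∧ j = 1 then 2
  else if n % 3 = 1 ∧ j = 2 then 1
  else if n % 3 = 2 ∧ (j = 1 ∨ j = 2) then j + 2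
  else if n % 3 = 2 ∧ (j = 3 ∨ j = 4) then j - 2
  else if q = 2 ∧ n ≠ 8 ∧ n ≠ 11 ∧ j = n - 7 then n - 4
  else if q = 2 ∧ n ≠ 8 ∧ n ≠ 11 ∧ j = n - 4 then n - 7
  else if n % 3 + 3 ≤ j ∧ j ≤ n - 6 ∧ j % 3 = n % 3 then j + 1
  else if n % 3 + 4 ≤ j ∧ j ≤ n - 5 ∧ j % 3 = (n + 1) % 3 then j - 1
  else j

/-- The permutation of the labels `1, …, n - 3` that describes the action of `y` on
`e_1, …, e_{n-3}`. With `n = 3 m + r`, it is the product over `0 ≤ i ≤ m - 2` of the cycles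
`3 i + 1 + r ↦ 3 i + 2 + r ↦ 3 i + 3 + r ↦ 3 i + 1 + r`. -/
def yPerm (n j : ℕ) : ℕ :=
  if j ≤ n % 3 then j
  else if j % 3 = n % 3 then j - 2
  else j + 1

section Generators

variable {K : Type*} [Field K]

/-- The element `c = a^{q+1} - 4`. -/
def cc (q : ℕ) (a : K) : K := a ^ (q + 1) - 4

/-- The element `γ = a^3 + a^{3q} - 6 a^{q+1} + 8`. -/
def gam (q : ℕ) (a : K) : K := a ^ 3 + a ^ (3 * q) - 6 * a ^ (q + 1) + 8

/-- The element `b = 2 a - a^{2q}`. -/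
def bb (q : ℕ) (a : K) : K := 2 * a - a ^ (2 * q)

/-- The standing assumptions on the parameters, with `q` a power of the characteristic `p` of the
field `K` with `q^2` elements: for `q = 2` there is no `a`, and `ω` is a primitive cube root of
unity; for `q > 2` there is no `ω`, and `a` is restricted as below. The ring `𝔽_p[z]` is the
subring generated by `z`. -/
def Admissible (p q : ℕ) (a ω : K) : Prop :=
  if q = 2 then IsPrimitiveRoot ω 3
  else if p = 3 then Subring.closure {a} = ⊤ ∧ a ^ q + a ^ (q - 1) + 1 = 0
  else Subring.closure {a ^ 3} = ⊤ ∧ cc q a ≠ 0 ∧ gam q a ≠ 0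

/-- The action of `x` on the span of `e_{n-3}, e_{n-2}, e_{n-1}, e_n`. -/
def xTail (p q : ℕ) (a ω : K) : Matrix (Fin 4) (Fin 4) K :=
  if q = 2 then
    !![1, 1, ω, 0;
       1, 0, ω, ω;
       ω ^ 2, ω ^ 2, 0, 1;
       0, ω ^ 2, 1, 1]
  else if p = 3 then
    !![0, 1, 0, 0;
       1, 0, 0, 0;
       0, 0, 0, 1;
       0, 0, 1, 0]
  else
    !![0, 1, 0, 0;
       1, 0, 0, 0;
       0, 0, -1, a;
       0, 0, 0, 1]

/-- The action of `y` on the span of `e_{n-2}, e_{n-1}, e_n`. -/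
def yTail (p q : ℕ) (a : K) : Matrix (Fin 3) (Fin 3) K :=
  if q = 2 then
    !![0, 0, 1;
       1, 0, 0;
       0, 1, 0]
  else if p = 3 then
    !![1, 0, a;
       -a ^ q, 1, a;
       0, 0, 1]
  else
    !![bb q a * (cc q a)⁻¹, -a ^ q * gam q a * (cc q a)⁻¹ ^ 2, 2 * gam q a * (cc q a)⁻¹ ^ 2;
       1, -bb q a * (cc q a)⁻¹, -bb q a ^ q * (cc q a)⁻¹;
       0, 1, 0]

/-- The matrix `x_n`; column `j` holds the coordinates of the image of `e_j`. -/
def xMat (p q n : ℕ) (a ω : K) : Matrix (Fin n) (Fin n) K :=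
  withTail n (fun i j => if i = xPerm n q j then 1 else 0) (xTail p q a ω)

/-- The matrix `y_n`; column `j` holds the coordinates of the image of `e_j`. -/
def yMat (p q n : ℕ) (a : K) : Matrix (Fin n) (Fin n) K :=
  withTail n (fun i j => if i = yPerm n j then 1 else 0) (yTail p q a)

/-- The Gram matrix `J_n` of the Hermitian form. -/
def formJ (p q n : ℕ) (a : K) : Matrix (Fin n) (Fin n) K :=
  if q = 2 then 1
  else if p = 3 then
    withTail n (fun i j => if i = j then 1 else 0) !![0, 1; 1, 0]
  else
    withTail n (fun i j => if i = j then cc q a else 0)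
      ((gam q a * (cc q a)⁻¹) • !![2, -a ^ q; -a, 2])

/-- The group `H` generated by the (invertible) matrices `(-1)^n x_n` and `y_n`. -/
def groupH (p q n : ℕ) (a ω : K) : Subgroup (GL (Fin n) K) :=
  Subgroup.closure {g | (g : Matrix (Fin n) (Fin n) K) = (-1 : K) ^ n • xMat p q n a ω ∨
    (g : Matrix (Fin n) (Fin n) K) = yMat p q n a}

end Generators

/-- The set `B_ℓ = {e_j | ℓ ≤ j ≤ n}`, where `i : Fin n` stands for `e_{i+1}`. -/
def tailSet (n l : ℕ) : Finset (Fin n) := Finset.univ.filter fun i => l ≤ i.val + 1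

end SUGen

/-! The inclusion of `H` in the special unitary group is a check on the generators (`groupH_le`).
For the converse, say that a set `B` of basis vectors is good if `H` contains every special unitary
matrix fixing all the basis vectors outside `B` (`ContainsSU`). Take a maximal good `B` containing
the last five basis vectors; `tailSet n l` shows that one exists. The claim is that `B` is
everything.

The geometric input is `IsHermitianForm.containsSU_insert`. If `g` is special unitary on `⟨B, e_i⟩`,
Witt's theorem inside `⟨B⟩` moves the `⟨B⟩`-component of `g e_i` into a plane `⟨e_k, e_l⟩`, which
has vectors of every norm because the norm of the quadratic extension is surjective. A second use of
Witt's theorem, on `e_i, e_k, e_l` and the last two basis vectors, brings the result back to `e_i`.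
What remains fixes `e_i`, so it lies in the group of `B`. Consequently every good set containing the
last four basis vectors is contained in the maximal `B`.

Outside `B` the generators permute basis vectors up to sign, so conjugation (`ContainsSU.image`)
makes the complements of `x(Bᶜ)` and `y(Bᶜ)` good. Hence `Bᶜ ⊆ x(Bᶜ)` and `Bᶜ ⊆ y(Bᶜ)`. But the
largest label in `Bᶜ` would be carried higher by `x` or within its `y`-cycle, so `Bᶜ` is empty
(`eq_univ_of_invariant`). -/

namespace SUGen

/-! ### Hermitian forms and nondegeneracy. -/

section Form

variable {K : Type*} [Field K] {ι : Type*} [Fintype ι]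

/-- The sesquilinear form with Gram matrix `J`. -/
def form (σ : K →+* K) (J : Matrix ι ι K) (u v : ι → K) : K := u ⬝ᵥ (J *ᵥ (σ ∘ v))

variable {σ : K →+* K} {J : Matrix ι ι K}

lemma form_add_left (u v w : ι → K) : form σ J (u + v) w = form σ J u w + form σ J v w := by
  simp [form, add_dotProduct]

lemma form_smul_left (s : K) (u v : ι → K) : form σ J (s • u) v = s * form σ J u v := by
  simp [form, smul_dotProduct]

lemma form_add_right (u v w : ι → K) : form σ J u (v + w) = form σ J u v + form σ J u w := by
  have : σ ∘ (v + w) = σ ∘ v + σ ∘ w := by ext; simp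
  simp [form, this, mulVec_add, dotProduct_add]

lemma form_smul_right (s : K) (u v : ι → K) : form σ J u (s • v) = σ s * form σ J u v := by
  have : σ ∘ (s • v) = σ s • (σ ∘ v) := by ext; simp
  simp [form, this, mulVec_smul, dotProduct_smul]

lemma form_sub_right (u v w : ι → K) : form σ J u (v - w) = form σ J u v - form σ J u w := by
  have : σ ∘ (v - w) = σ ∘ v - σ ∘ w := by ext; simp
  simp [form, this, mulVec_sub, dotProduct_sub]

lemma form_sub_left (u v w : ι → K) : form σ J (u - v) w = form σ J u w - form σ J v w := by
  simp [form, sub_dotProduct]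

lemma form_zero_left (v : ι → K) : form σ J 0 v = 0 := by simp [form]

lemma form_mulVec_mulVec (g : Matrix ι ι K) (u v : ι → K) :
    form σ J (g *ᵥ u) (g *ᵥ v) = form σ (gᵀ * J * g.map σ) u v := by
  have : σ ∘ (g *ᵥ v) = g.map σ *ᵥ (σ ∘ v) := by
    ext i; exact RingHom.map_mulVec σ g v i
  simp only [form, this, ← mulVec_mulVec]
  rw [dotProduct_mulVec u, vecMul_transpose]

variable [DecidableEq ι]

lemma form_single_single (i j : ι) :
    form σ J (Pi.single i 1) (Pi.single j 1) = J i j := by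
  have : σ ∘ (Pi.single j (1 : K) : ι → K) = Pi.single j 1 := by
    ext k; by_cases h : k = j <;> simp [h]
  simp [form, this]

lemma unitary_iff (g : Matrix ι ι K) :
    gᵀ * J * g.map σ = J ↔ ∀ u v, form σ J (g *ᵥ u) (g *ᵥ v) = form σ J u v := by
  constructor
  · intro h u v
    rw [form_mulVec_mulVec, h]
  · intro h
    ext i j
    rw [← form_single_single (σ := σ) (J := gᵀ * J * g.map σ), ← form_mulVec_mulVec, h,
      form_single_single]

/-- A nondegenerate Hermitian form with respect to the involution `σ`, for which the basis vectors
indexed by `D` all have norm `c ≠ 0` and are orthogonal to all the other basis vectors. -/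
structure IsHermitianForm (σ : K →+* K) (J : Matrix ι ι K) (D : Set ι) (c : K) : Prop where
  invol : ∀ x, σ (σ x) = x
  herm : Jᵀ = J.map σ
  diag : ∀ i ∈ D, ∀ j, J i j = if i = j then c else 0
  c_ne : c ≠ 0
  map_c : σ c = c
  det_ne : J.det ≠ 0

variable {D : Set ι} {c : K}

namespace IsHermitianForm

variable (hJ : IsHermitianForm σ J D c)
include hJ

lemma map_form (u v : ι → K) : σ (form σ J u v) = form σ J v u := by
  have h1 : σ (form σ J u v) = (σ ∘ u) ⬝ᵥ (J.map σ *ᵥ v) := by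
    simp only [form, RingHom.map_dotProduct]
    congr 1
    ext i
    rw [Function.comp_apply, RingHom.map_mulVec]
    congr 2
    ext j
    simp [hJ.invol]
  rw [h1, ← hJ.herm, form, dotProduct_mulVec, vecMul_transpose, dotProduct_comm]

lemma map_apply (i j : ι) : σ (J i j) = J j i := by
  simpa using (congrFun (congrFun hJ.herm i) j).symm

lemma single_form {i : ι} (hi : i ∈ D) (v : ι → K) :
    form σ J (Pi.single i 1) v = c * σ (v i) := by
  simp only [form, single_one_dotProduct]
  simp [mulVec, dotProduct, hJ.diag i hi]

lemma form_single {i : ι} (hi : i ∈ D) (v : ι → K) :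
    form σ J v (Pi.single i 1) = v i * c := by
  rw [← hJ.map_form, hJ.single_form hi, map_mul, hJ.invol, hJ.map_c, mul_comm]

lemma nondeg {u : ι → K} (hu : u ≠ 0) : ∃ z, form σ J u z ≠ 0 := by
  by_contra! h
  apply hJ.det_ne
  rw [← det_transpose, ← exists_mulVec_eq_zero_iff]
  refine ⟨u, hu, ?_⟩
  ext i
  have := h (Pi.single i 1)
  have e : σ ∘ (Pi.single i (1 : K) : ι → K) = Pi.single i 1 := by
    ext k; by_cases h : k = i <;> simp [h]
  rw [form, e, dotProduct_mulVec, dotProduct_single_one] at this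
  rw [mulVec_transpose]
  exact this

/-- The basis vectors outside `B` split off orthogonally, so truncating a test vector to `B` does
not change its product with `u`. -/
lemma nondeg_on {B : Set ι} (hB : Bᶜ ⊆ D) {u : ι → K} (hu : u ≠ 0) (huB : ∀ i ∉ B, u i = 0) :
    ∃ z : ι → K, (∀ i ∉ B, z i = 0) ∧ form σ J u z ≠ 0 := by
  classical
  obtain ⟨z, hz⟩ := hJ.nondeg hu
  let z' : ι → K := fun i => if i ∈ B then z i else 0
  refine ⟨z', fun i hi => by simp [z', hi], ?_⟩
  have key : form σ J u z = form σ J u z' := by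
    simp only [form, dotProduct, mulVec, Finset.mul_sum]
    refine Finset.sum_congr rfl fun i _ => Finset.sum_congr rfl fun j _ => ?_
    by_cases hj : j ∈ B
    · simp [z', hj]
    · rw [← hJ.map_apply j i, hJ.diag j (hB hj)]
      split_ifs with h
      · subst h; simp [huB _ hj]
      · simp
  rwa [← key]

lemma det_norm {g : Matrix ι ι K} (hg : gᵀ * J * g.map σ = J) : g.det * σ g.det = 1 := by
  have := congrArg det hg
  rw [det_mul, det_mul, det_transpose] at this
  have e : (g.map σ).det = σ g.det := (RingHom.map_det σ g).symm
  rw [e] at this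
  apply mul_left_cancel₀ hJ.det_ne
  linear_combination this

end IsHermitianForm

/-! ### Quasi-reflections and Witt's theorem for vectors. -/

/-- The map `x ↦ x + s (x, w) w`. -/
def quasiReflection (σ : K →+* K) (J : Matrix ι ι K) (w : ι → K) (s : K) : Matrix ι ι K :=
  1 + vecMulVec (s • w) (J *ᵥ (σ ∘ w))

lemma quasiReflection_mulVec (w : ι → K) (s : K) (x : ι → K) :
    quasiReflection σ J w s *ᵥ x = x + (s * form σ J x w) • w := by
  rw [quasiReflection, add_mulVec, one_mulVec, vecMulVec_mulVec, dotProduct_comm]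
  ext i
  simp [form]
  ring

lemma det_quasiReflection (w : ι → K) (s : K) :
    (quasiReflection σ J w s).det = 1 + s * form σ J w w := by
  have : vecMulVec (s • w) (J *ᵥ (σ ∘ w)) =
      replicateCol Unit (s • w) * replicateRow Unit (J *ᵥ (σ ∘ w)) := by
    ext i j; simp [vecMulVec_apply, mul_apply]
  rw [quasiReflection, this, det_one_add_replicateCol_mul_replicateRow, dotProduct_comm]
  simp [form, smul_dotProduct]

/-- `g` preserves the form and fixes the basis vectors outside `B`. -/
def IsUnitaryOn (σ : K →+* K) (J : Matrix ι ι K) (B : Set ι) (g : Matrix ι ι K) : Prop :=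
  gᵀ * J * g.map σ = J ∧ ∀ i ∉ B, g *ᵥ Pi.single i 1 = Pi.single i 1

lemma IsUnitaryOn.mul {B : Set ι} {g h : Matrix ι ι K} (hg : IsUnitaryOn σ J B g)
    (hh : IsUnitaryOn σ J B h) : IsUnitaryOn σ J B (g * h) := by
  refine ⟨?_, fun i hi => ?_⟩
  · rw [unitary_iff]
    intro u v
    rw [← mulVec_mulVec, ← mulVec_mulVec, (unitary_iff g).1 hg.1, (unitary_iff h).1 hh.1]
  · rw [← mulVec_mulVec, hh.2 i hi, hg.2 i hi]

lemma IsUnitaryOn.mono {B C : Set ι} {g : Matrix ι ι K} (hg : IsUnitaryOn σ J B g)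
    (h : B ⊆ C) : IsUnitaryOn σ J C g :=
  ⟨hg.1, fun i hi => hg.2 i fun h' => hi (h h')⟩

namespace IsHermitianForm

variable (hJ : IsHermitianForm σ J D c)
include hJ

/-- The form changes by `(u, w)(w, v)` times the left side of `hs`. -/
lemma isUnitaryOn_quasiReflection {B : Set ι} (hB : Bᶜ ⊆ D) {w : ι → K} (hw : ∀ i ∉ B, w i = 0)
    {s : K} (hs : s + σ s + s * σ s * form σ J w w = 0) :
    IsUnitaryOn σ J B (quasiReflection σ J w s) := by
  refine ⟨?_, fun i hi => ?_⟩
  · rw [unitary_iff]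
    intro u v
    simp only [quasiReflection_mulVec, form_add_left, form_add_right, form_smul_left,
      form_smul_right, map_mul, hJ.map_form]
    linear_combination form σ J u w * form σ J w v * hs
  · rw [quasiReflection_mulVec, hJ.single_form (hB hi), hw i hi]
    simp

/-- For `i ∈ D` the `i`-th coordinate of `u` is `(u, e_i) / c`, and `g` preserves the form and fixes
`e_i`. In matrix terms, trivial columns outside `B` force trivial rows. -/
lemma apply_eq_zero {B : Set ι} (hB : Bᶜ ⊆ D) {g : Matrix ι ι K} (hg : IsUnitaryOn σ J B g)
    {u : ι → K} {i : ι} (hi : i ∉ B) : (g *ᵥ u) i = u i := by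
  have := (unitary_iff g).1 hg.1 u (Pi.single i 1)
  rw [hg.2 i hi, hJ.form_single (hB hi), hJ.form_single (hB hi)] at this
  exact mul_right_cancel₀ hJ.c_ne this

/-- There is a nonzero `s` for which the quasi-reflection in `w` is unitary. -/
lemma exists_scalar (hσ : ∃ t, σ t ≠ t) (w : ι → K) :
    ∃ s ≠ 0, s + σ s + s * σ s * form σ J w w = 0 := by
  obtain ⟨t, ht⟩ := hσ
  -- For isotropic `w` the condition says that `s` has trace zero.
  by_cases hw : form σ J w w = 0
  · refine ⟨t - σ t, sub_ne_zero.2 fun h => ht h.symm, ?_⟩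
    simp [hw, hJ.invol]
  · have ht0 : t ≠ 0 := by rintro rfl; simp at ht
    have ht1 : σ t ≠ 0 := by simpa using ht0
    -- Chosen so that the determinant `1 + s (w, w)` is `σ t / t`, an element of norm one different
    -- from `1`.
    refine ⟨(σ t / t - 1) / form σ J w w, ?_, ?_⟩
    · refine div_ne_zero (sub_ne_zero.2 fun h => ht ?_) hw
      rwa [div_eq_one_iff_eq ht0] at h
    · simp only [map_div₀, map_sub, map_one, hJ.invol, hJ.map_form]
      field_simp
      ring

-- A vector space is not the union of two proper subspaces.
omit hJ [DecidableEq ι] in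
lemma exists_form_ne_ne {B : Set ι} {u v : ι → K}
    (hu : ∃ z : ι → K, (∀ i ∉ B, z i = 0) ∧ form σ J u z ≠ 0)
    (hv : ∃ z : ι → K, (∀ i ∉ B, z i = 0) ∧ form σ J v z ≠ 0) :
    ∃ z : ι → K, (∀ i ∉ B, z i = 0) ∧ form σ J u z ≠ 0 ∧ form σ J v z ≠ 0 := by
  obtain ⟨z, hz, huz⟩ := hu
  obtain ⟨y, hy, hvy⟩ := hv
  by_cases h1 : form σ J v z = 0
  · by_cases h2 : form σ J u y = 0
    · refine ⟨z + y, fun i hi => by simp [hz i hi, hy i hi], ?_, ?_⟩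
      · simpa [form_add_right, h2]
      · simpa [form_add_right, h1]
    · exact ⟨y, hy, h2, hvy⟩
  · exact ⟨z, hz, huz, h1⟩

/-- The quasi-reflection in `u - v` sending `u` to `v` has coefficient `-1 / (u, u - v)`. Equality
of norms gives `(u - v, u - v)` as the trace of `(u, u - v)`, which is the unitarity condition. -/
lemma exists_unitary_of_form_sub_ne {B : Set ι} (hB : Bᶜ ⊆ D) {u v : ι → K}
    (huB : ∀ i ∉ B, u i = 0) (hvB : ∀ i ∉ B, v i = 0) (h : form σ J u u = form σ J v v)
    (h' : form σ J u v ≠ form σ J u u) : ∃ g, IsUnitaryOn σ J B g ∧ g *ᵥ u = v := by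
  have h1 : form σ J u (u - v) ≠ 0 := by
    rw [form_sub_right]; exact sub_ne_zero.2 h'.symm
  have h2 : σ (form σ J u (u - v)) ≠ 0 := by simpa using h1
  refine ⟨quasiReflection σ J (u - v) (-(form σ J u (u - v))⁻¹),
    hJ.isUnitaryOn_quasiReflection hB (fun i hi => by simp [huB i hi, hvB i hi]) ?_, ?_⟩
  · have h3 : form σ J (u - v) (u - v) = form σ J u (u - v) + σ (form σ J u (u - v)) := by
      rw [hJ.map_form]
      simp only [form_sub_left, form_sub_right, h]
      ring
    rw [h3, map_neg, map_inv₀]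
    field_simp
    ring
  · rw [quasiReflection_mulVec, neg_mul, inv_mul_cancel₀ h1]
    simp

/-- Witt's theorem for vectors. -/
lemma exists_unitary (hσ : ∃ t, σ t ≠ t) {B : Set ι} (hB : Bᶜ ⊆ D) {u v : ι → K}
    (huB : ∀ i ∉ B, u i = 0) (hvB : ∀ i ∉ B, v i = 0) (hu : u ≠ 0) (hv : v ≠ 0)
    (h : form σ J u u = form σ J v v) : ∃ g, IsUnitaryOn σ J B g ∧ g *ᵥ u = v := by
  by_cases h' : form σ J u v = form σ J u u
  -- In the degenerate case, first perturb `u` by a quasi-reflection in some `z` orthogonal to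
  -- neither vector: this changes `(u, v)` by `s (u, z)(z, v) ≠ 0`.
  · obtain ⟨z, hz, huz, hvz⟩ := exists_form_ne_ne (hJ.nondeg_on hB hu huB)
      (hJ.nondeg_on hB hv hvB)
    obtain ⟨s, hs, hsz⟩ := hJ.exists_scalar hσ z
    have hR := hJ.isUnitaryOn_quasiReflection hB hz hsz
    have hzv : form σ J z v ≠ 0 := by rw [← hJ.map_form]; simpa using hvz
    have hn := (unitary_iff _).1 hR.1 u u
    obtain ⟨g, hg, hgu⟩ := hJ.exists_unitary_of_form_sub_ne hB
      (u := quasiReflection σ J z s *ᵥ u) (v := v)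
      (fun i hi => by rw [hJ.apply_eq_zero hB hR hi, huB i hi]) hvB (by rw [hn, h])
      (by
        rw [hn, quasiReflection_mulVec, form_add_left, form_smul_left, h']
        simp [hs, huz, hzv])
    exact ⟨g * quasiReflection σ J z s, hg.mul hR, by rw [← mulVec_mulVec, hgu]⟩
  · exact hJ.exists_unitary_of_form_sub_ne hB huB hvB h h'

/-- Witt's theorem for vectors, with elements of determinant one. -/
lemma exists_special (hσ : ∃ t, σ t ≠ t) {B : Set ι} (hB : Bᶜ ⊆ D) {u v z : ι → K}
    (huB : ∀ i ∉ B, u i = 0) (hvB : ∀ i ∉ B, v i = 0) (hzB : ∀ i ∉ B, z i = 0)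
    (hu : u ≠ 0) (hv : v ≠ 0) (h : form σ J u u = form σ J v v)
    (hz : form σ J z z ≠ 0) (hvz : form σ J v z = 0) :
    ∃ g, IsUnitaryOn σ J B g ∧ g.det = 1 ∧ g *ᵥ u = v := by
  obtain ⟨g, hg, hgu⟩ := hJ.exists_unitary hσ hB huB hvB hu hv h
  have hd := hJ.det_norm hg.1
  -- The quasi-reflection in `z ⊥ v` fixes `v`. Its determinant is `σ (det g)`, the inverse of `det
  -- g` because `det g` has norm one.
  refine ⟨quasiReflection σ J z ((σ g.det - 1) / form σ J z z) * g,
    (hJ.isUnitaryOn_quasiReflection hB hzB ?_).mul hg, ?_, ?_⟩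
  · simp only [map_div₀, map_sub, map_one, hJ.invol, hJ.map_form]
    field_simp
    linear_combination hd
  · rw [det_mul, det_quasiReflection, div_mul_cancel₀ _ hz]
    linear_combination hd
  · rw [← mulVec_mulVec, hgu, quasiReflection_mulVec, hvz]
    simp

end IsHermitianForm

/-! ### Special unitary subgroups supported on sets of basis vectors. -/

/-- `H` contains all elements of the special unitary group that fix the basis vectors outside
`B`. -/
def ContainsSU (σ : K →+* K) (J : Matrix ι ι K) (H : Subgroup (GL ι K)) (B : Set ι) : Prop :=
  ∀ g : GL ι K, IsUnitaryOn σ J B (g : Matrix ι ι K) → (g : Matrix ι ι K).det = 1 → g ∈ H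

lemma ContainsSU.anti {H : Subgroup (GL ι K)} {B C : Set ι} (h : ContainsSU σ J H C)
    (hBC : B ⊆ C) : ContainsSU σ J H B :=
  fun g hg hd => h g (hg.mono hBC) hd

lemma IsHermitianForm.containsSU_of_partialSU_le (hJ : IsHermitianForm σ J D c)
    {H : Subgroup (GL ι K)} {B : Finset ι} (hB : (B : Set ι)ᶜ ⊆ D) (h : partialSU σ J B ≤ H) :
    ContainsSU σ J H B := by
  intro g hg hd
  apply h
  set g' : Matrix {i // i ∈ B} {i // i ∈ B} K :=
    (g : Matrix ι ι K).submatrix Subtype.val Subtype.val with hg'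
  have hcol : ∀ j ∉ B, ∀ i, (g : Matrix ι ι K) i j = (1 : Matrix ι ι K) i j := by
    intro j hj i
    have := congrFun (hg.2 j (by simpa using hj)) i
    rw [mulVec_single_one] at this
    simpa [Pi.single_apply, Matrix.one_apply] using this
  have hrow : ∀ i ∉ B, ∀ j, (g : Matrix ι ι K) i j = (1 : Matrix ι ι K) i j := by
    intro i hi j
    have := hJ.apply_eq_zero hB hg (u := Pi.single j 1) (i := i) (by simpa using hi)
    rw [mulVec_single_one] at this
    simpa [Pi.single_apply, Matrix.one_apply] using this
  have hext : extendById B g' = (g : Matrix ι ι K) := by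
    ext i j
    have e : ∀ k : ι, (Equiv.sumCompl (· ∈ B)).symm k =
        if h : k ∈ B then Sum.inl ⟨k, h⟩ else Sum.inr ⟨k, h⟩ := by
      intro k
      split_ifs with h
      · exact Equiv.sumCompl_symm_apply_of_pos h
      · exact Equiv.sumCompl_symm_apply_of_neg h
    simp only [extendById, MonoidHom.coe_mk, OneHom.coe_mk, reindex_apply, submatrix_apply, e]
    by_cases hi : i ∈ B <;> by_cases hj : j ∈ B
    · simp [hi, hj, hg']
    · have : i ≠ j := by rintro rfl; exact hj hi
      simp [hi, hj, hcol j hj, this]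
    · have : i ≠ j := by rintro rfl; exact hi hj
      simp [hi, hj, hrow i hi, this]
    · simp [hi, hj, hrow i hi, Matrix.one_apply]
  have hdet : g'.det = 1 := by
    rw [← hd, ← hext]
    simp [extendById]
  have hun : g'ᵀ * J.submatrix (Subtype.val : {i // i ∈ B} → ι) Subtype.val * g'.map σ =
      J.submatrix Subtype.val Subtype.val := by
    ext i j
    have h1 := congrFun (congrFun hg.1 i) j
    simp only [mul_apply, transpose_apply, submatrix_apply, hg'] at h1 ⊢
    rw [← h1, ← Finset.sum_subset (Finset.subset_univ B), ← Finset.sum_coe_sort B]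
    · refine Finset.sum_congr rfl fun k _ => ?_
      congr 1
      rw [← Finset.sum_subset (Finset.subset_univ B), ← Finset.sum_coe_sort B]
      intro l _ hl
      have : l ≠ i := by rintro rfl; exact hl i.2
      simp [hrow l hl, this]
    · intro l _ hl
      have : l ≠ j := by rintro rfl; exact hl j.2
      simp [hrow l hl, this]
  refine ⟨GeneralLinearGroup.mkOfDetNeZero g' (by simp [hdet]), ⟨hun, hdet⟩, ?_⟩
  ext i j
  exact congrFun (congrFun hext i) j

/-- If `H` contains the special unitary groups of `⟨B⟩` and of `⟨e_i, e_k, e_l⟩ ⊥ ⟨Dᶜ⟩`, where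
`k, l ∈ B`, then it contains that of `⟨B, e_i⟩`. -/
lemma IsHermitianForm.containsSU_insert (hJ : IsHermitianForm σ J D c)
    (hσ : ∃ t, σ t ≠ t) (hN : ∀ t, σ t = t → ∃ α, α * σ α = t)
    {H : Subgroup (GL ι K)} {B : Set ι} (hB : Bᶜ ⊆ D) {i k l m : ι} (hk : k ∈ B) (hl : l ∈ B)
    (hm : m ∈ B) (hkD : k ∈ D) (hlD : l ∈ D) (hmD : m ∈ D) (hkl : k ≠ l) (hkm : k ≠ m)
    (hlm : l ≠ m) (hHB : ContainsSU σ J H B) (hHi : ContainsSU σ J H ({i, k, l} ∪ Dᶜ)) :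
    ContainsSU σ J H (insert i B) := by
  by_cases hi : i ∈ B
  · rwa [Set.insert_eq_of_mem hi]
  have hiD : i ∈ D := hB hi
  have hik : i ≠ k := by rintro rfl; exact hi hk
  have hil : i ≠ l := by rintro rfl; exact hi hl
  have him : i ≠ m := by rintro rfl; exact hi hm
  set C : Set ι := {i, k, l} ∪ Dᶜ with hC
  have hCD : Cᶜ ⊆ D := fun j hj => by by_contra h; exact hj (Or.inr h)
  have hCB : C ⊆ insert i B := by
    rintro j ((rfl | rfl | rfl) | h)
    · exact Or.inl rfl
    · exact Or.inr hk
    · exact Or.inr hl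
    · by_contra h'
      exact h (hB fun h'' => h' (Or.inr h''))
  have hBi : (insert i B)ᶜ ⊆ D := fun j hj => hB fun h => hj (Or.inr h)
  intro g hg hd
  set v : ι → K := (g : Matrix ι ι K) *ᵥ Pi.single i 1 with hv
  have hvB : ∀ j ∉ insert i B, v j = 0 := by
    intro j hj
    rw [hv, hJ.apply_eq_zero hBi hg hj]
    have : j ≠ i := by rintro rfl; exact hj (Or.inl rfl)
    simp [this]
  set w : ι → K := v - v i • Pi.single i 1 with hw
  have hvw : v = w + v i • Pi.single i 1 := by simp [hw]
  have hwi : w i = 0 := by simp [hw]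
  have hwB : ∀ j ∉ B, w j = 0 := by
    intro j hj
    by_cases hji : j = i
    · rw [hji, hwi]
    · have : j ∉ insert i B := by rintro (h | h) <;> contradiction
      simp [hw, hvB j this, hji]
  have hei : ∀ s : K, ∀ u : ι → K, u i = 0 →
      form σ J (u + s • Pi.single i 1) (u + s • Pi.single i 1) = form σ J u u + s * σ s * c := by
    intro s u hu
    simp only [form_add_left, form_add_right, form_smul_left, form_smul_right,
      hJ.single_form hiD, hJ.form_single hiD]
    simp [hu]
    ring
  have hnv : form σ J v v = c := by
    rw [hv, (unitary_iff _).1 hg.1, hJ.single_form hiD]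
    simp
  have hc : σ c = c := hJ.map_c
  have hself : ∀ j ∈ D, form σ J (Pi.single j 1) (Pi.single j 1) = c := by
    intro j hj; rw [hJ.single_form hj]; simp
  -- move `w` into the plane spanned by `e_k` and `e_l`
  obtain ⟨h₁, hh₁, hd₁, hh₁v⟩ : ∃ h₁ : Matrix ι ι K, IsUnitaryOn σ J B h₁ ∧ h₁.det = 1 ∧
      ∃ w' : ι → K, (∀ j ∉ C, w' j = 0) ∧ w' i = 0 ∧ form σ J w w = form σ J w' w' ∧
        h₁ *ᵥ w = w' := by
    by_cases hw0 : w = 0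
    · refine ⟨1, ⟨by simp [Matrix.map_one], fun j _ => one_mulVec _⟩, by simp, 0, by simp, by simp, ?_, ?_⟩
      · rw [hw0]
      · simp [hw0]
    have hNw : σ (form σ J w w / c) = form σ J w w / c := by
      rw [map_div₀, hJ.map_form, hc]
    obtain ⟨w', hw'0, hw'C, hw'n⟩ : ∃ w' : ι → K, w' ≠ 0 ∧ (∀ j, j ≠ k → j ≠ l → w' j = 0) ∧
        form σ J w' w' = form σ J w w := by
      by_cases hnw : form σ J w w = 0
      -- As `e_k` and `e_l` both have norm `c`, `α e_k + e_l` is isotropic exactly when `α` has norm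
      -- `-1`.
      · obtain ⟨α, hα⟩ := hN (-1) (by simp)
        refine ⟨α • Pi.single k 1 + Pi.single l 1, ?_, ?_, ?_⟩
        · intro h
          have := congrFun h l
          simp [hkl.symm] at this
        · intro j h1 h2
          simp [h1, h2]
        · simp only [form_add_left, form_add_right, form_smul_left, form_smul_right,
            hJ.single_form hkD, hJ.single_form hlD, hnw]
          simp [hkl, hkl.symm]
          linear_combination c * hα
      · obtain ⟨α, hα⟩ := hN _ hNw
        refine ⟨α • Pi.single k 1, ?_, ?_, ?_⟩
        · intro h
          have := congrFun h k
          simp only [Pi.smul_apply, Pi.single_eq_same, smul_eq_mul, mul_one, Pi.zero_apply] at this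
          rw [this, zero_mul] at hα
          exact div_ne_zero hnw hJ.c_ne hα.symm
        · intro j h1 h2
          simp [h1]
        · rw [form_smul_left, form_smul_right, hself k hkD, ← mul_assoc, hα,
            div_mul_cancel₀ _ hJ.c_ne]
    -- The third vector `e_m` serves to correct the determinant: it is orthogonal to the target in
    -- `⟨e_k, e_l⟩`.
    obtain ⟨g₁, hg₁, hd₁, hg₁w⟩ := hJ.exists_special hσ hB hwB (v := w') (z := Pi.single m 1)
      (fun j hj => hw'C j (by rintro rfl; exact hj hk) (by rintro rfl; exact hj hl))
      (fun j hj => Pi.single_eq_of_ne (by rintro rfl; exact hj hm) _) hw0 hw'0 hw'n.symm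
      (by rw [hself m hmD]; exact hJ.c_ne)
      (by rw [hJ.form_single hmD, hw'C m hkm.symm hlm.symm, zero_mul])
    refine ⟨g₁, hg₁, hd₁, w', fun j hj => hw'C j ?_ ?_, hw'C i hik hil, hw'n.symm, hg₁w⟩
    · rintro rfl; exact hj (by simp [hC])
    · rintro rfl; exact hj (by simp [hC])
  obtain ⟨w', hw'C, hw'i, hw'n, hh₁w⟩ := hh₁v
  have hh₁v : h₁ *ᵥ v = w' + v i • Pi.single i 1 := by
    conv_lhs => rw [hvw]
    rw [mulVec_add, mulVec_smul, hh₁w, hh₁.2 i hi]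
  have hnv' : form σ J (w' + v i • Pi.single i 1) (w' + v i • Pi.single i 1) = c := by
    rw [hei _ _ hw'i, ← hw'n, ← hei _ _ hwi, ← hvw, hnv]
  -- Here the target is `e_i`, so `e_k` is available for the determinant correction.
  obtain ⟨h₂, hh₂, hd₂, hh₂v⟩ := hJ.exists_special hσ hCD
    (u := w' + v i • Pi.single i 1) (v := Pi.single i 1) (z := Pi.single k 1)
    (fun j hj => by
      have : j ≠ i := by rintro rfl; exact hj (by simp [hC])
      simp [hw'C j hj, this])
    (fun j hj => Pi.single_eq_of_ne (by rintro rfl; exact hj (by simp [hC])) _)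
    (fun j hj => Pi.single_eq_of_ne (by rintro rfl; exact hj (by simp [hC])) _)
    (fun h => by
      rw [h, form_zero_left] at hnv'
      exact hJ.c_ne hnv'.symm)
    (by simp) (by rw [hnv', hself i hiD]) (by rw [hself k hkD]; exact hJ.c_ne)
    (by rw [hJ.form_single hkD]; simp [hik.symm])
  let g₁ : GL ι K := GeneralLinearGroup.mkOfDetNeZero h₁ (by simp [hd₁])
  let g₂ : GL ι K := GeneralLinearGroup.mkOfDetNeZero h₂ (by simp [hd₂])
  have hg₁ : g₁ ∈ H := hHB g₁ hh₁ hd₁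
  have hg₂ : g₂ ∈ H := hHi g₂ hh₂ hd₂
  have hprod : g₂ * g₁ * g ∈ H := by
    have hu : IsUnitaryOn σ J (insert i B) (h₂ * h₁ * (g : Matrix ι ι K)) :=
      ((hh₂.mono hCB).mul (hh₁.mono (Set.subset_insert _ _))).mul hg
    refine hHB _ ⟨hu.1, fun j hj => ?_⟩ ?_
    · by_cases hji : j = i
      · subst hji
        change (h₂ * h₁ * (g : Matrix ι ι K)) *ᵥ Pi.single j 1 = _
        rw [← mulVec_mulVec, ← mulVec_mulVec, ← hv, hh₁v, hh₂v]
      · exact hu.2 j (by rintro (h | h) <;> contradiction)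
    · change (h₂ * h₁ * (g : Matrix ι ι K)).det = 1
      rw [det_mul, det_mul, hd₁, hd₂, hd]
      simp
  have : g = (g₂ * g₁)⁻¹ * (g₂ * g₁ * g) := by group
  rw [this]
  exact H.mul_mem (H.inv_mem (H.mul_mem hg₂ hg₁)) hprod

/-- Conjugation by a unitary element of `H` that permutes the basis vectors outside `B`. -/
lemma ContainsSU.image {H : Subgroup (GL ι K)} {B C : Set ι} (hB : ContainsSU σ J H B)
    {g : GL ι K} (hg : g ∈ H) (hgU : g ∈ specialUnitary σ J)
    (h : ∀ j ∉ B, ∃ j' ∉ C, ∃ s : K,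
      (g : Matrix ι ι K) *ᵥ Pi.single j 1 = s • Pi.single j' 1) :
    ContainsSU σ J H C := by
  intro x hx hd
  have hmem : g⁻¹ * x * g ∈ specialUnitary σ J :=
    mul_mem (mul_mem (inv_mem hgU) ⟨hx.1, hd⟩) hgU
  have key : g⁻¹ * x * g ∈ H := by
    refine hB _ ⟨hmem.1, fun j hj => ?_⟩ hmem.2
    obtain ⟨j', hj', s, e⟩ := h j hj
    rw [Units.val_mul, Units.val_mul, ← mulVec_mulVec, e, mulVec_smul, ← mulVec_mulVec,
      hx.2 j' hj', ← mulVec_smul, ← e, mulVec_mulVec, ← Units.val_mul, inv_mul_cancel,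
      Units.val_one, one_mulVec]
  have : x = g * (g⁻¹ * x * g) * g⁻¹ := by group
  rw [this]
  exact H.mul_mem (H.mul_mem hg key) (H.inv_mem hg)

end Form

/-! ### The involution and the norm on the field with `q²` elements. -/

section FiniteField

variable {K : Type*} [Field K] {p f : ℕ} [Fact p.Prime] [CharP K p]

omit [Field K] [CharP K p] in
lemma finite_of_card (hK : Nat.card K = (p ^ f) ^ 2) : Finite K :=
  Nat.finite_of_card_ne_zero (by
    rw [hK]; exact pow_ne_zero _ (pow_ne_zero _ (Fact.out : p.Prime).ne_zero))

lemma iterateFrobenius_invol (hK : Nat.card K = (p ^ f) ^ 2) (x : K) :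
    iterateFrobenius K p f (iterateFrobenius K p f x) = x := by
  have := finite_of_card hK
  have := Fintype.ofFinite K
  rw [iterateFrobenius_def, iterateFrobenius_def, ← pow_mul, ← sq, ← hK, Nat.card_eq_fintype_card,
    FiniteField.pow_card]

/-- Otherwise `X^q - X`, of degree `q`, would have `q²` roots. -/
lemma exists_iterateFrobenius_ne (hf : 1 ≤ f) (hK : Nat.card K = (p ^ f) ^ 2) :
    ∃ t : K, iterateFrobenius K p f t ≠ t := by
  by_contra! h
  have := finite_of_card hK
  have := Fintype.ofFinite K
  have hq : 1 < p ^ f := Nat.one_lt_pow (by lia) (Fact.out : p.Prime).one_lt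
  have hne : (Polynomial.X ^ (p ^ f) - Polynomial.X : Polynomial K) ≠ 0 :=
    FiniteField.X_pow_card_sub_X_ne_zero K hq
  have hdeg := FiniteField.X_pow_card_sub_X_natDegree_eq K hq
  have hle := Polynomial.card_le_degree_of_subset_roots
    (p := (Polynomial.X ^ (p ^ f) - Polynomial.X : Polynomial K)) (Z := Finset.univ) (by
      intro t _
      rw [Polynomial.mem_roots hne]
      have := h t
      rw [iterateFrobenius_def] at this
      simp [this])
  rw [hdeg, Finset.card_univ, ← Nat.card_eq_fintype_card, hK] at hle
  nlinarith

/-- The unit group is cyclic of order `(q - 1)(q + 1)`. A nonzero `t` fixed by the involution has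
`t^(q-1) = 1`, so it is a `(q + 1)`-th power, and `α^(q+1)` is the norm of `α`. -/
lemma exists_norm_eq (hf : 1 ≤ f) (hK : Nat.card K = (p ^ f) ^ 2) (t : K)
    (ht : iterateFrobenius K p f t = t) : ∃ α, α * iterateFrobenius K p f α = t := by
  have := finite_of_card hK
  rw [iterateFrobenius_def] at ht
  simp only [iterateFrobenius_def]
  have hq : 1 < p ^ f := Nat.one_lt_pow (by lia) (Fact.out : p.Prime).one_lt
  set q := p ^ f
  by_cases h0 : t = 0
  · exact ⟨0, by simp [h0]⟩
  obtain ⟨g, hg⟩ := IsCyclic.exists_monoid_generator (α := Kˣ)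
  obtain ⟨k, hk⟩ := Submonoid.mem_powers_iff _ _ |>.1 (hg (Units.mk0 t h0))
  have hog : orderOf g = (q - 1) * (q + 1) := by
    have h1 : orderOf g = Nat.card Kˣ := orderOf_eq_card_of_forall_mem_powers hg
    rw [h1, Nat.card_units, hK]
    obtain ⟨r, hr⟩ := Nat.exists_eq_add_of_lt hq
    rw [show q = r + 2 by lia]
    simp only [show r + 2 - 1 = r + 1 by lia]
    have : (r + 2) ^ 2 = (r + 1) * (r + 2 + 1) + 1 := by ring
    lia
  have hu : (Units.mk0 t h0) ^ (q - 1) = 1 := by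
    ext
    rw [Units.val_pow_eq_pow_val, Units.val_mk0, Units.val_one]
    apply mul_left_cancel₀ h0
    rw [← pow_succ', Nat.sub_add_cancel hq.le, ht, mul_one]
  rw [← hk, ← pow_mul] at hu
  have hdvd := orderOf_dvd_of_pow_eq_one hu
  rw [hog, mul_comm] at hdvd
  obtain ⟨j, rfl⟩ := Nat.dvd_of_mul_dvd_mul_right (by lia) hdvd
  refine ⟨((g ^ j : Kˣ) : K), ?_⟩
  have := congrArg Units.val hk
  rw [Units.val_mk0] at this
  rw [← this, ← pow_succ', ← Units.val_pow_eq_pow_val, ← pow_mul, mul_comm]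

end FiniteField

/-! ### Block matrices with a permutation block and a tail. -/

section Blocks

variable {K : Type*} [Field K]

lemma withTail_eq_reindex (N k : ℕ) (U : ℕ → ℕ → K) (T : Matrix (Fin k) (Fin k) K) :
    withTail (N + k) U T = reindex finSumFinEquiv finSumFinEquiv
      (fromBlocks (of fun i j : Fin N => U (i + 1) (j + 1)) 0 0 T) := by
  rw [← Equiv.symm_apply_eq]
  ext i j
  rcases i with i | i <;> rcases j with j | j <;>
    simp only [withTail, submatrix_apply, reindex_symm, reindex_apply, Equiv.symm_symm,
      finSumFinEquiv_apply_left, finSumFinEquiv_apply_right, of_apply, fromBlocks_apply₁₁,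
      fromBlocks_apply₁₂, fromBlocks_apply₂₁, fromBlocks_apply₂₂, Fin.val_castAdd, Fin.val_natAdd,
      Matrix.zero_apply] <;>
    split_ifs <;> first | rfl | lia | (congr 1 <;> ext <;> simp)

lemma det_fin_four (A : Matrix (Fin 4) (Fin 4) K) :
    A.det = A 0 0 * (A 1 1 * (A 2 2 * A 3 3 - A 2 3 * A 3 2) -
        A 1 2 * (A 2 1 * A 3 3 - A 2 3 * A 3 1) + A 1 3 * (A 2 1 * A 3 2 - A 2 2 * A 3 1)) -
      A 0 1 * (A 1 0 * (A 2 2 * A 3 3 - A 2 3 * A 3 2) -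
        A 1 2 * (A 2 0 * A 3 3 - A 2 3 * A 3 0) + A 1 3 * (A 2 0 * A 3 2 - A 2 2 * A 3 0)) +
      A 0 2 * (A 1 0 * (A 2 1 * A 3 3 - A 2 3 * A 3 1) -
        A 1 1 * (A 2 0 * A 3 3 - A 2 3 * A 3 0) + A 1 3 * (A 2 0 * A 3 1 - A 2 1 * A 3 0)) -
      A 0 3 * (A 1 0 * (A 2 1 * A 3 2 - A 2 2 * A 3 1) -
        A 1 1 * (A 2 0 * A 3 2 - A 2 2 * A 3 0) + A 1 2 * (A 2 0 * A 3 1 - A 2 1 * A 3 0)) := by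
  simp [det_succ_row_zero, Fin.sum_univ_succ, Fin.succAbove]
  ring

/-- The `N × N` matrix of the map `g` of the labels `1, …, N`. -/
def labelMatrix (K : Type*) [Field K] (N : ℕ) (g : ℕ → ℕ) : Matrix (Fin N) (Fin N) K :=
  of fun i j => if i.val + 1 = g (j.val + 1) then 1 else 0

lemma labelMatrix_transpose_mul {N : ℕ} {g : ℕ → ℕ}
    (hg : ∀ j, 1 ≤ j → j ≤ N → 1 ≤ g j ∧ g j ≤ N)
    (hinj : ∀ i j, 1 ≤ i → i ≤ N → 1 ≤ j → j ≤ N → g i = g j → i = j) :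
    (labelMatrix K N g)ᵀ * labelMatrix K N g = 1 := by
  ext i j
  obtain ⟨h1, h2⟩ := hg (i + 1) (by lia) (by lia)
  rw [mul_apply, Finset.sum_eq_single ⟨g (i + 1) - 1, by lia⟩]
  · have e : g (i + 1) - 1 + 1 = g (i + 1) := by lia
    have : g (i + 1) = g (j + 1) ↔ i = j :=
      ⟨fun h => by have := hinj _ _ (by lia) (by lia) (by lia) (by lia) h; ext; lia,
        fun h => by rw [h]⟩
    simp [labelMatrix, e, this, Matrix.one_apply]
  · intro k _ hk
    have : k.val + 1 ≠ g (i + 1) := fun h => hk (by ext; simp; lia)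
    simp [labelMatrix, this]
  · simp

lemma map_labelMatrix (σ : K →+* K) (N : ℕ) (g : ℕ → ℕ) :
    (labelMatrix K N g).map σ = labelMatrix K N g := by
  ext i j
  simp only [labelMatrix, map_apply, of_apply]
  split_ifs <;> simp

lemma withTail_label (N k : ℕ) (g : ℕ → ℕ) (T : Matrix (Fin k) (Fin k) K) :
    withTail (N + k) (fun i j => if i = g j then 1 else 0) T =
      reindex finSumFinEquiv finSumFinEquiv (fromBlocks (labelMatrix K N g) 0 0 T) :=
  withTail_eq_reindex N k _ T

lemma withTail_scalar (N k : ℕ) (c : K) (T : Matrix (Fin k) (Fin k) K) :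
    withTail (N + k) (fun i j => if i = j then c else 0) T =
      reindex finSumFinEquiv finSumFinEquiv
        (fromBlocks (c • (1 : Matrix (Fin N) (Fin N) K)) 0 0 T) := by
  rw [withTail_eq_reindex]
  congr 2
  ext i j
  simp [Matrix.one_apply, Fin.ext_iff]

/-- The form has a tail of size 2, while `x` and `y` have tails of size 4 and 3. This regroups the
form into blocks compatible with either generator. -/
lemma withTail_withTail (n k l : ℕ) (hlk : l ≤ k) (hkn : k ≤ n) (c : K)
    (T : Matrix (Fin l) (Fin l) K) :
    withTail n (fun i j => if i = j then c else 0)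
      (withTail k (fun i j => if i = j then c else 0) T) =
      withTail n (fun i j => if i = j then c else 0) T := by
  ext i j
  have e1 : ∀ i : ℕ, i - (n - k) - (k - l) = i - (n - l) := by lia
  simp only [withTail, of_apply, e1]
  split_ifs <;> first | rfl | lia

lemma withTail_unitary {σ : K →+* K} {N k : ℕ} {c : K} {g : ℕ → ℕ}
    (hg : ∀ j, 1 ≤ j → j ≤ N → 1 ≤ g j ∧ g j ≤ N)
    (hinj : ∀ i j, 1 ≤ i → i ≤ N → 1 ≤ j → j ≤ N → g i = g j → i = j)
    {T J : Matrix (Fin k) (Fin k) K} (hT : Tᵀ * J * T.map σ = J) :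
    (withTail (N + k) (fun i j => if i = g j then 1 else 0) T)ᵀ *
      withTail (N + k) (fun i j => if i = j then c else 0) J *
      (withTail (N + k) (fun i j => if i = g j then 1 else 0) T).map σ =
    withTail (N + k) (fun i j => if i = j then c else 0) J := by
  rw [withTail_label, withTail_scalar]
  simp only [reindex_apply, transpose_submatrix, ← submatrix_map, submatrix_mul_equiv]
  rw [fromBlocks_transpose, fromBlocks_map, fromBlocks_multiply, fromBlocks_multiply]
  simp [hT, map_labelMatrix, labelMatrix_transpose_mul hg hinj]

lemma det_withTail_label (N k : ℕ) (g : ℕ → ℕ) (T : Matrix (Fin k) (Fin k) K) :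
    (withTail (N + k) (fun i j => if i = g j then 1 else 0) T).det =
      (labelMatrix K N g).det * T.det := by
  rw [withTail_label, det_reindex_self, det_fromBlocks_zero₂₁]

/-- The inductive step for the determinants of `x` and `y`: enlarging the label set adds an
independent block. -/
lemma det_labelMatrix_add (N k : ℕ) (g g' : ℕ → ℕ)
    (h : ∀ j, 1 ≤ j → j ≤ N → g' j = g j ∧ 1 ≤ g j ∧ g j ≤ N) (τ : Fin k → Fin k)
    (hτ : ∀ i : Fin k, g' (N + i + 1) = N + τ i + 1) :
    (labelMatrix K (N + k) g').det = (labelMatrix K N g).det *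
      (of fun i j => if i = τ j then (1 : K) else 0 : Matrix (Fin k) (Fin k) K).det := by
  rw [← det_withTail_label, withTail_label]
  congr 1
  rw [← Equiv.symm_apply_eq]
  ext i j
  rcases i with i | i <;> rcases j with j | j
  · simp [labelMatrix, (h (j + 1) (by lia) (by lia)).1]
  · have := hτ j
    simp [labelMatrix, this]
    lia
  · have := h (j + 1) (by lia) (by lia)
    simp [labelMatrix, this.1]
    lia
  · have := hτ j
    simp [labelMatrix, this, Fin.ext_iff]

end Blocks

/-! ### The permutations of the labels and their signs. -/

section Labels

lemma xPerm_mem {n q j : ℕ} (hn : 8 ≤ n) (h1 : 1 ≤ j) (h2 : j ≤ n - 4) :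
    1 ≤ xPerm n q j ∧ xPerm n q j ≤ n - 4 := by
  unfold xPerm; split_ifs <;> omega

set_option maxHeartbeats 4000000 in
lemma xPerm_xPerm {n q j : ℕ} (hn : 8 ≤ n) (h1 : 1 ≤ j) (h2 : j ≤ n - 4) :
    xPerm n q (xPerm n q j) = j := by
  have : ∀ k, xPerm n q j = k → xPerm n q k = j := by
    intro k hk
    unfold xPerm at hk
    split_ifs at hk <;>
    · unfold xPerm
      repeat' first | (rw [if_pos (by omega)]; omega) | rw [if_neg (by omega)]
      all_goals omega
  exact this _ rfl

lemma xPerm_inj {n q i j : ℕ} (hn : 8 ≤ n) (hi1 : 1 ≤ i) (hi2 : i ≤ n - 4) (hj1 : 1 ≤ j)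
    (hj2 : j ≤ n - 4) (h : xPerm n q i = xPerm n q j) : i = j := by
  rw [← xPerm_xPerm hn hi1 hi2, h, xPerm_xPerm hn hj1 hj2]

/-- For `q = 2` this would fail, since the extra swap of `n - 7` and `n - 4` moves with `n`. -/
lemma xPerm_add_of_le {q M j : ℕ} (hq : q ≠ 2) (hM : 2 ≤ M) (h2 : j ≤ M) :
    xPerm (M + 3 + 4) q j = xPerm (M + 4) q j := by
  have h : (M + 3 + 4) % 3 = (M + 4) % 3 := by omega
  unfold xPerm
  rw [h]
  simp only [hq, false_and, if_false]
  repeat' (refine ite_congr (propext ?_) (fun _ => rfl) fun _ => ?_)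
  all_goals first | rfl | omega

lemma xPerm_add_one {q M : ℕ} (hq : q ≠ 2) (hM : 2 ≤ M) :
    xPerm (M + 3 + 4) q (M + 1) = M + 2 := by
  unfold xPerm
  simp only [hq, false_and, if_false]
  split_ifs <;> omega

lemma xPerm_add_two {q M : ℕ} (hq : q ≠ 2) (hM : 2 ≤ M) :
    xPerm (M + 3 + 4) q (M + 2) = M + 1 := by
  unfold xPerm
  simp only [hq, false_and, if_false]
  split_ifs <;> omega

lemma xPerm_add_three {q M : ℕ} (hq : q ≠ 2) (hM : 2 ≤ M) :
    xPerm (M + 3 + 4) q (M + 3) = M + 3 := by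
  unfold xPerm
  simp only [hq, false_and, if_false]
  split_ifs <;> omega

lemma xPerm_mem_of_ne_two {q M j : ℕ} (hq : q ≠ 2) (hM : 2 ≤ M) (h1 : 1 ≤ j) (h2 : j ≤ M) :
    1 ≤ xPerm (M + 4) q j ∧ xPerm (M + 4) q j ≤ M := by
  unfold xPerm
  simp only [hq, false_and, if_false]
  split_ifs <;> omega

lemma yPerm_mem {n j : ℕ} (h1 : 1 ≤ j) (h2 : j ≤ n - 3) :
    1 ≤ yPerm n j ∧ yPerm n j ≤ n - 3 := by
  unfold yPerm; split_ifs <;> omega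

lemma yPerm_inj {n i j : ℕ} (hi1 : 1 ≤ i) (hj1 : 1 ≤ j)
    (h : yPerm n i = yPerm n j) : i = j := by
  unfold yPerm at h
  split_ifs at h <;> omega

variable (K : Type*) [Field K]

/-- Three more labels contribute one transposition and one fixed point, hence a factor `-1 =
(-1)^3`. The cases `N = 2, 3, 4` start the three residue classes. -/
lemma det_labelMatrix_xPerm {q : ℕ} (hq : q ≠ 2) (N : ℕ) (hN : 2 ≤ N) :
    (labelMatrix K N (xPerm (N + 4) q)).det = (-1) ^ N := by
  induction N using Nat.strong_induction_on with
  | _ N ih =>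
    by_cases h5 : 5 ≤ N
    · obtain ⟨M, rfl⟩ := Nat.exists_eq_add_of_le' (show 3 ≤ N by lia)
      have step := det_labelMatrix_add (K := K) M 3 (xPerm (M + 4) q) (xPerm (M + 3 + 4) q) ?_
        ![1, 0, 2] ?_
      · rw [step, ih M (by lia) (by lia), pow_add]
        congr 1
        simp [det_fin_three]
        norm_num
      · intro j h1 h2
        exact ⟨xPerm_add_of_le hq (by lia) h2, xPerm_mem_of_ne_two hq (by lia) h1 h2⟩
      · intro i
        fin_cases i
        · simpa using xPerm_add_one hq (by lia)
        · simpa using xPerm_add_two hq (by lia)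
        · simpa using xPerm_add_three hq (by lia)
    · have : N = 2 ∨ N = 3 ∨ N = 4 := by lia
      rcases this with rfl | rfl | rfl
      · simp [det_fin_two, labelMatrix, xPerm, hq]
      · simp [det_fin_three, labelMatrix, xPerm, hq]
        norm_num
      · rw [det_fin_four]
        simp [labelMatrix, xPerm, hq]
        norm_num

lemma det_labelMatrix_yPerm (N : ℕ) :
    (labelMatrix K N (yPerm (N + 3))).det = 1 := by
  induction N using Nat.strong_induction_on with
  | _ N ih =>
    by_cases h3 : 3 ≤ N
    · obtain ⟨M, rfl⟩ := Nat.exists_eq_add_of_le' h3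
      have step := det_labelMatrix_add (K := K) M 3 (yPerm (M + 3)) (yPerm (M + 3 + 3)) ?_
        ![1, 2, 0] ?_
      · rw [step, ih M (by lia)]
        simp [det_fin_three]
      · intro j h1 h2
        unfold yPerm
        refine ⟨?_, ?_, ?_⟩ <;> split_ifs <;> omega
      · intro i
        unfold yPerm
        fin_cases i <;> simp <;> split_ifs <;> omega
    · have : labelMatrix K N (yPerm (N + 3)) = 1 := by
        ext i j
        have : yPerm (N + 3) (j.val + 1) = j.val + 1 := by
          unfold yPerm; split_ifs <;> omega
        simp [labelMatrix, this, Matrix.one_apply, Fin.ext_iff]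
      rw [this, det_one]

end Labels

/-! ### Unitarity of the exceptional blocks of `x` and `y`. -/

section Tails

variable {K : Type*} [Field K]

/-- The norm of the first `n - 2` basis vectors. -/
def formC (p q : ℕ) (a : K) : K := if q = 2 ∨ p = 3 then 1 else cc q a

/-- The Gram matrix of the form on the last two basis vectors. -/
def formTail (p q : ℕ) (a : K) : Matrix (Fin 2) (Fin 2) K :=
  if q = 2 then 1 else if p = 3 then !![0, 1; 1, 0] else
    (gam q a * (cc q a)⁻¹) • !![2, -a ^ q; -a, 2]

lemma formJ_eq (p q n : ℕ) (a : K) :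
    formJ p q n a = withTail n (fun i j => if i = j then formC p q a else 0) (formTail p q a) := by
  unfold formJ formC formTail
  split_ifs with h1 h2 h3 h4
  · ext i j
    simp only [withTail, of_apply, Matrix.one_apply, Fin.ext_iff]
    split_ifs <;> first | rfl | lia
  all_goals first | rfl | simp_all

lemma withTail_three (c : K) (T : Matrix (Fin 2) (Fin 2) K) :
    withTail 3 (fun i j => if i = j then c else 0) T =
      !![c, 0, 0; 0, T 0 0, T 0 1; 0, T 1 0, T 1 1] := by
  ext i j
  fin_cases i <;> fin_cases j <;> simp [withTail]

lemma withTail_four (c : K) (T : Matrix (Fin 2) (Fin 2) K) :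
    withTail 4 (fun i j => if i = j then c else 0) T =
      !![c, 0, 0, 0; 0, c, 0, 0; 0, 0, T 0 0, T 0 1; 0, 0, T 1 0, T 1 1] := by
  ext i j
  fin_cases i <;> fin_cases j <;> simp [withTail]

lemma xTail_unitary_two {σ : K →+* K} {ω : K} (h2 : (2 : K) = 0) (hω : ω ^ 2 + ω + 1 = 0)
    (hσ : σ ω = ω ^ 2) :
    let T : Matrix (Fin 4) (Fin 4) K :=
      !![1, 1, ω, 0; 1, 0, ω, ω; ω ^ 2, ω ^ 2, 0, 1; 0, ω ^ 2, 1, 1]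
    Tᵀ * 1 * T.map σ = 1 ∧ T.det = 1 := by
  intro T
  refine ⟨?_, ?_⟩
  · ext i j
    fin_cases i <;> fin_cases j <;>
      simp [T, mul_apply, Fin.sum_univ_four, hσ] <;> grind
  · rw [det_fin_four]
    simp [T]
    grind

lemma yTail_unitary_two {σ : K →+* K} :
    let T : Matrix (Fin 3) (Fin 3) K := !![0, 0, 1; 1, 0, 0; 0, 1, 0]
    Tᵀ * 1 * T.map σ = 1 ∧ T.det = 1 := by
  intro T
  refine ⟨?_, ?_⟩
  · ext i j
    fin_cases i <;> fin_cases j <;>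
      simp [T, mul_apply, Fin.sum_univ_three]
  · simp [T, det_fin_three]

lemma xTail_unitary_three {σ : K →+* K} :
    let T : Matrix (Fin 4) (Fin 4) K := !![0, 1, 0, 0; 1, 0, 0, 0; 0, 0, 0, 1; 0, 0, 1, 0]
    let J : Matrix (Fin 4) (Fin 4) K := !![1, 0, 0, 0; 0, 1, 0, 0; 0, 0, 0, 1; 0, 0, 1, 0]
    Tᵀ * J * T.map σ = J ∧ T.det = 1 := by
  intro T J
  refine ⟨?_, ?_⟩
  · ext i j
    fin_cases i <;> fin_cases j <;>
      simp [T, J, mul_apply, Fin.sum_univ_four]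
  · rw [det_fin_four]
    simp [T]

/-- The hypothesis `h` says that the last column is isotropic. -/
lemma yTail_unitary_three {σ : K →+* K} {a a' : K} (hσ : σ a = a') (hσ' : σ a' = a)
    (h : a * a' + a + a' = 0) :
    let T : Matrix (Fin 3) (Fin 3) K := !![1, 0, a; -a', 1, a; 0, 0, 1]
    let J : Matrix (Fin 3) (Fin 3) K := !![1, 0, 0; 0, 0, 1; 0, 1, 0]
    Tᵀ * J * T.map σ = J ∧ T.det = 1 := by
  intro T J
  refine ⟨?_, ?_⟩
  · ext i j
    fin_cases i <;> fin_cases j <;>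
      simp [T, J, mul_apply, Fin.sum_univ_three, hσ, hσ']
    grind
  · simp [T, det_fin_three]

lemma xTail_unitary_general {σ : K →+* K} {a a' c s : K} (hσ : σ a = a') :
    let T : Matrix (Fin 4) (Fin 4) K := !![0, 1, 0, 0; 1, 0, 0, 0; 0, 0, -1, a; 0, 0, 0, 1]
    let J : Matrix (Fin 4) (Fin 4) K :=
      !![c, 0, 0, 0; 0, c, 0, 0; 0, 0, s * 2, s * -a'; 0, 0, s * -a, s * 2]
    Tᵀ * J * T.map σ = J ∧ T.det = 1 := by
  intro T J
  refine ⟨?_, ?_⟩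
  · ext i j
    fin_cases i <;> fin_cases j <;>
      simp [T, J, mul_apply, Fin.sum_univ_four, hσ] <;> ring
  · rw [det_fin_four]
    simp [T]

/-- The involution fixes `c` and `γ` and exchanges `b` and `b'`, so each entry becomes a rational
identity in `a` and `a'`. -/
lemma yTail_unitary_general {σ : K →+* K} {a a' b b' c γ : K} (hσ : σ a = a') (hσ' : σ a' = a)
    (hc : c = a * a' - 4) (hb : b = 2 * a - a' ^ 2) (hb' : b' = 2 * a' - a ^ 2)
    (hγ : γ = a ^ 3 + a' ^ 3 - 6 * (a * a') + 8) (hc0 : c ≠ 0) :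
    let T : Matrix (Fin 3) (Fin 3) K :=
      !![b * c⁻¹, -a' * γ * c⁻¹ ^ 2, 2 * γ * c⁻¹ ^ 2; 1, -b * c⁻¹, -b' * c⁻¹; 0, 1, 0]
    let J : Matrix (Fin 3) (Fin 3) K :=
      !![c, 0, 0; 0, γ * c⁻¹ * 2, γ * c⁻¹ * -a'; 0, γ * c⁻¹ * -a, γ * c⁻¹ * 2]
    Tᵀ * J * T.map σ = J ∧ T.det = 1 := by
  intro T J
  have hσc : σ c = c := by rw [hc]; simp [hσ, hσ', mul_comm, map_ofNat]
  have hσb : σ b = b' := by rw [hb, hb']; simp [hσ, hσ', map_ofNat]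
  have hσb' : σ b' = b := by rw [hb, hb']; simp [hσ, hσ', map_ofNat]
  have hσγ : σ γ = γ := by rw [hγ]; simp [hσ, hσ', map_ofNat]; ring
  have key : 2 * γ = c ^ 2 - b * b' := by rw [hγ, hc, hb, hb']; ring
  refine ⟨?_, ?_⟩
  · ext i j
    fin_cases i <;> fin_cases j <;>
      simp [T, J, mul_apply, Fin.sum_univ_three, hσ', hσc, hσb, hσb', hσγ, map_ofNat] <;>
      field_simp <;> subst hγ hb hb' hc <;> ring
  · simp [T, det_fin_three]
    field_simp
    subst hγ hb hb' hc
    ring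

end Tails

/-! ### The generators are special unitary; invariant sets of labels. -/

section Main

variable {K : Type*} [Field K] {p f : ℕ} [Fact p.Prime] [CharP K p]

lemma eq_two_of_pow_eq_two (h : p ^ f = 2) : p = 2 := by
  have hf : f ≠ 0 := by rintro rfl; simp at h
  exact (Nat.prime_dvd_prime_iff_eq (Fact.out : p.Prime) Nat.prime_two).1
    (h ▸ dvd_pow_self p hf)

lemma map_cc (hK : Nat.card K = (p ^ f) ^ 2) (a : K) :
    iterateFrobenius K p f (cc (p ^ f) a) = cc (p ^ f) a := by
  rw [cc, pow_succ, map_sub, map_mul, map_ofNat, ← iterateFrobenius_def,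
    iterateFrobenius_invol hK]
  ring

lemma map_gam (hK : Nat.card K = (p ^ f) ^ 2) (a : K) :
    iterateFrobenius K p f (gam (p ^ f) a) = gam (p ^ f) a := by
  rw [gam, mul_comm 3, pow_mul, pow_succ a (p ^ f), ← iterateFrobenius_def]
  simp only [map_sub, map_add, map_mul, map_ofNat, map_pow, iterateFrobenius_invol hK]
  ring

lemma bb_pow (hK : Nat.card K = (p ^ f) ^ 2) (a : K) :
    bb (p ^ f) a ^ p ^ f = 2 * a ^ p ^ f - a ^ 2 := by
  have h := iterateFrobenius_invol hK a
  simp only [iterateFrobenius_def] at h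
  rw [← iterateFrobenius_def, bb, mul_comm 2 (p ^ f), pow_mul]
  simp only [map_sub, map_mul, map_ofNat, map_pow, iterateFrobenius_def, h]

lemma xTail_unitary {a ω : K}
    (ha : Admissible p (p ^ f) a ω) :
    (xTail p (p ^ f) a ω)ᵀ * withTail 4 (fun i j => if i = j then formC p (p ^ f) a else 0)
      (formTail p (p ^ f) a) * (xTail p (p ^ f) a ω).map (iterateFrobenius K p f) =
      withTail 4 (fun i j => if i = j then formC p (p ^ f) a else 0) (formTail p (p ^ f) a) ∧
    (xTail p (p ^ f) a ω).det = 1 := by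
  rw [withTail_four]
  unfold Admissible at ha
  unfold xTail formC formTail
  by_cases hq : p ^ f = 2
  · have hp := eq_two_of_pow_eq_two hq
    have h2 : (2 : K) = 0 := by
      have := CharP.cast_eq_zero K p
      rwa [hp, Nat.cast_ofNat] at this
    rw [if_pos hq] at ha
    have hω : ω ^ 2 + ω + 1 = 0 := by
      have h1 : ω ≠ 1 := ha.ne_one (by norm_num)
      have h3 := ha.pow_eq_one
      apply mul_left_cancel₀ (sub_ne_zero.2 h1)
      linear_combination h3
    have := xTail_unitary_two (σ := iterateFrobenius K p f) h2 hω
      (by rw [iterateFrobenius_def, hq])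
    simp only [hq, if_true, true_or]
    have e : !![(1 : K), 0, 0, 0; 0, 1, 0, 0;
        0, 0, (1 : Matrix (Fin 2) (Fin 2) K) 0 0, (1 : Matrix (Fin 2) (Fin 2) K) 0 1;
        0, 0, (1 : Matrix (Fin 2) (Fin 2) K) 1 0, (1 : Matrix (Fin 2) (Fin 2) K) 1 1] = 1 := by
      ext i j
      fin_cases i <;> fin_cases j <;> simp
    rw [e]
    exact this
  · by_cases hp : p = 3
    · simp only [if_neg hq, if_pos hp, if_pos (show p ^ f = 2 ∨ p = 3 from Or.inr hp)]
      simpa using xTail_unitary_three (σ := iterateFrobenius K p f)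
    · simp only [hq, hp, or_self, if_false]
      exact xTail_unitary_general (iterateFrobenius_def p f a)

lemma yTail_unitary (hK : Nat.card K = (p ^ f) ^ 2) {a ω : K}
    (ha : Admissible p (p ^ f) a ω) :
    (yTail p (p ^ f) a)ᵀ * withTail 3 (fun i j => if i = j then formC p (p ^ f) a else 0)
      (formTail p (p ^ f) a) * (yTail p (p ^ f) a).map (iterateFrobenius K p f) =
      withTail 3 (fun i j => if i = j then formC p (p ^ f) a else 0) (formTail p (p ^ f) a) ∧
    (yTail p (p ^ f) a).det = 1 := by
  rw [withTail_three]
  unfold Admissible at ha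
  unfold yTail formC formTail
  have hσ := iterateFrobenius_def p f a
  have hσ' : iterateFrobenius K p f (a ^ p ^ f) = a := by
    rw [← hσ]; exact iterateFrobenius_invol hK a
  by_cases hq : p ^ f = 2
  · simp only [hq, if_true, true_or]
    have e : !![(1 : K), 0, 0;
        0, (1 : Matrix (Fin 2) (Fin 2) K) 0 0, (1 : Matrix (Fin 2) (Fin 2) K) 0 1;
        0, (1 : Matrix (Fin 2) (Fin 2) K) 1 0, (1 : Matrix (Fin 2) (Fin 2) K) 1 1] = 1 := by
      ext i j
      fin_cases i <;> fin_cases j <;> simp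
    rw [e]
    exact yTail_unitary_two
  · by_cases hp : p = 3
    · simp only [if_neg hq, if_pos hp, if_pos (show p ^ f = 2 ∨ p = 3 from Or.inr hp)] at ha ⊢
      -- This is the standing relation `a^q + a^(q-1) + 1 = 0` multiplied by `a`.
      have h : a * a ^ p ^ f + a + a ^ p ^ f = 0 := by
        have e : a * a ^ (p ^ f - 1) = a ^ p ^ f := by
          rw [← pow_succ', Nat.sub_add_cancel (Nat.one_le_pow _ _ (Fact.out : p.Prime).pos)]
        linear_combination a * ha.2 - e
      simpa using yTail_unitary_three hσ hσ' h
    · simp only [hq, hp, or_self, if_false] at ha ⊢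
      refine yTail_unitary_general hσ hσ' ?_ ?_ ?_ ?_ ha.2.1
      · rw [cc, pow_succ']
      · rw [bb, mul_comm 2 (p ^ f), pow_mul]
      · exact bb_pow hK a
      · rw [gam, mul_comm 3 (p ^ f), pow_mul, pow_succ' a (p ^ f)]

lemma isHermitianForm_formJ (hK : Nat.card K = (p ^ f) ^ 2) {n : ℕ} (hn : 2 ≤ n) {a ω : K}
    (ha : Admissible p (p ^ f) a ω) :
    IsHermitianForm (iterateFrobenius K p f) (formJ p (p ^ f) n a) {i | i.val + 2 < n}
      (formC p (p ^ f) a) := by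
  obtain ⟨N, rfl⟩ := Nat.exists_eq_add_of_le' hn
  have hc : formC p (p ^ f) a ≠ 0 ∧
      iterateFrobenius K p f (formC p (p ^ f) a) = formC p (p ^ f) a := by
    unfold Admissible at ha
    unfold formC
    split_ifs at ha ⊢ <;> simp_all [map_cc hK]
  have hinv := iterateFrobenius_invol hK a
  rw [iterateFrobenius_def] at hinv
  have hT : (formTail p (p ^ f) a)ᵀ = (formTail p (p ^ f) a).map (iterateFrobenius K p f) := by
    unfold formTail
    split_ifs
    · simp [Matrix.map_one]
    · ext i j; fin_cases i <;> fin_cases j <;> simp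
    · ext i j
      fin_cases i <;> fin_cases j <;> simp [map_gam hK, map_cc hK, hinv, map_ofNat]
      simp [iterateFrobenius_def]
  have hdet : (formTail p (p ^ f) a).det ≠ 0 := by
    unfold Admissible at ha
    unfold formTail
    split_ifs at ha ⊢
    · simp
    · simp [det_fin_two]
    · obtain ⟨-, h1, h2⟩ := ha
      -- The determinant of the last block is `(γ/c)² (4 - a^(q+1)) = -(γ/c)² c`.
      have : (gam (p ^ f) a * (cc (p ^ f) a)⁻¹) ≠ 0 := mul_ne_zero h2 (inv_ne_zero h1)
      rw [det_smul]
      refine mul_ne_zero (pow_ne_zero _ this) ?_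
      rw [det_fin_two]
      intro h
      apply h1
      simp at h
      rw [cc, pow_succ']
      linear_combination -h
  refine ⟨iterateFrobenius_invol hK, ?_, ?_, hc.1, hc.2, ?_⟩
  · rw [formJ_eq, withTail_scalar, reindex_apply, transpose_submatrix, ← submatrix_map,
      fromBlocks_transpose, fromBlocks_map, hT]
    congr 2
    · ext i j
      by_cases h : i = j
      · simp [h, hc.2]
      · simp [h, Ne.symm h]
    · ext; simp
    · ext; simp
  · intro i hi j
    have hi' : ¬ N + 2 - 2 ≤ i.val := by
      simp only [Set.mem_ofPred_eq] at hi; lia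
    rw [formJ_eq]
    simp only [withTail, of_apply, dif_neg hi', Fin.ext_iff]
    split_ifs <;> first | rfl | lia
  · rw [formJ_eq, withTail_scalar, det_reindex_self, det_fromBlocks_zero₂₁, det_smul, det_one,
      mul_one]
    exact mul_ne_zero (pow_ne_zero _ hc.1) hdet

lemma xMat_unitary {n : ℕ} (hn : 8 ≤ n) {a ω : K}
    (ha : Admissible p (p ^ f) a ω) :
    (xMat p (p ^ f) n a ω)ᵀ * formJ p (p ^ f) n a *
      (xMat p (p ^ f) n a ω).map (iterateFrobenius K p f) = formJ p (p ^ f) n a := by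
  obtain ⟨N, rfl⟩ := Nat.exists_eq_add_of_le' (show 4 ≤ n by lia)
  rw [formJ_eq, ← withTail_withTail _ 4 2 (by lia) (by lia)]
  exact withTail_unitary (fun j h1 h2 => xPerm_mem hn h1 h2)
    (fun i j hi1 hi2 hj1 hj2 => xPerm_inj hn hi1 hi2 hj1 hj2) (xTail_unitary ha).1

lemma yMat_unitary (hK : Nat.card K = (p ^ f) ^ 2) {n : ℕ} (hn : 8 ≤ n) {a ω : K}
    (ha : Admissible p (p ^ f) a ω) :
    (yMat p (p ^ f) n a)ᵀ * formJ p (p ^ f) n a *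
      (yMat p (p ^ f) n a).map (iterateFrobenius K p f) = formJ p (p ^ f) n a := by
  obtain ⟨N, rfl⟩ := Nat.exists_eq_add_of_le' (show 3 ≤ n by lia)
  rw [formJ_eq, ← withTail_withTail _ 3 2 (by lia) (by lia)]
  exact withTail_unitary (fun j h1 h2 => yPerm_mem (n := N + 3) h1 h2)
    (fun i j hi1 _ hj1 _ => yPerm_inj (n := N + 3) hi1 hj1) (yTail_unitary hK ha).1

lemma det_yMat (hK : Nat.card K = (p ^ f) ^ 2) {n : ℕ} (hn : 8 ≤ n) {a ω : K}
    (ha : Admissible p (p ^ f) a ω) : (yMat p (p ^ f) n a).det = 1 := by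
  obtain ⟨N, rfl⟩ := Nat.exists_eq_add_of_le' (show 3 ≤ n by lia)
  rw [yMat, det_withTail_label, det_labelMatrix_yPerm, (yTail_unitary hK ha).2, one_mul]

lemma det_xMat {n : ℕ} (hn : 8 ≤ n) {a ω : K}
    (ha : Admissible p (p ^ f) a ω) : (xMat p (p ^ f) n a ω).det = (-1) ^ n := by
  obtain ⟨N, rfl⟩ := Nat.exists_eq_add_of_le' (show 4 ≤ n by lia)
  rw [xMat, det_withTail_label, (xTail_unitary ha).2, mul_one]
  by_cases hq : p ^ f = 2
  · have hp := eq_two_of_pow_eq_two hq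
    have h2 : (2 : K) = 0 := by
      have := CharP.cast_eq_zero K p
      rwa [hp, Nat.cast_ofNat] at this
    have h1 : (-1 : K) = 1 := by linear_combination -h2
    have h := congrArg det (labelMatrix_transpose_mul (K := K) (N := N)
      (fun j h1 h2 => xPerm_mem (q := p ^ f) hn h1 h2)
      (fun i j hi1 hi2 hj1 hj2 => xPerm_inj hn hi1 hi2 hj1 hj2))
    rw [det_mul, det_transpose, det_one] at h
    -- A permutation matrix has determinant of square `1`, so in characteristic 2 the square of `det
    -- - 1` vanishes.
    rw [h1, one_pow, ← sub_eq_zero]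
    refine pow_eq_zero_iff (two_ne_zero) |>.1 ?_
    linear_combination h + h2 * (1 - (labelMatrix K N (xPerm (N + 4) (p ^ f))).det)
  · rw [det_labelMatrix_xPerm K hq N (by lia), pow_add]
    norm_num

lemma groupH_le (hK : Nat.card K = (p ^ f) ^ 2) {n : ℕ} (hn : 8 ≤ n) {a ω : K}
    (ha : Admissible p (p ^ f) a ω) :
    groupH p (p ^ f) n a ω ≤ specialUnitary (iterateFrobenius K p f) (formJ p (p ^ f) n a) := by
  rw [groupH, Subgroup.closure_le]
  have hs : ((-1 : K) ^ n) * (-1) ^ n = 1 := by rw [← mul_pow]; simp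
  rintro g (hg | hg)
  · refine ⟨?_, ?_⟩
    · rw [unitary_iff, hg]
      intro u v
      rw [smul_mulVec, smul_mulVec, form_smul_left, form_smul_right,
        (unitary_iff _).1 (xMat_unitary hn ha)]
      rw [map_pow, map_neg, map_one, ← mul_assoc, hs, one_mul]
    -- The determinant is `(-1)^(n²) (-1)^n = (-1)^(n(n+1)) = 1`; this is why `x` carries the sign
    -- `(-1)^n`.
    · rw [hg, det_smul, det_xMat hn ha, Fintype.card_fin, ← pow_mul, ← pow_add]
      exact Even.neg_one_pow (by rw [← Nat.mul_succ]; exact Nat.even_mul_succ_self n)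
  · refine ⟨?_, ?_⟩
    · rw [hg]; exact yMat_unitary hK hn ha
    · rw [hg, det_yMat hK hn ha]

lemma withTail_label_mulVec_single {n k : ℕ} {g : ℕ → ℕ} {T : Matrix (Fin k) (Fin k) K}
    {j : Fin n} (hj : j.val < n - k) (h : 1 ≤ g (j + 1) ∧ g (j + 1) ≤ n - k) {i : Fin n}
    (hi : i.val + 1 = g (j + 1)) :
    withTail n (fun i j => if i = g j then 1 else 0) T *ᵥ Pi.single j 1 = Pi.single i 1 := by
  rw [mulVec_single_one]
  ext l
  have hj' : ¬ n - k ≤ j.val := by lia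
  simp only [withTail, col_apply, of_apply, dif_neg hj', if_neg hj', Pi.single_apply, Fin.ext_iff]
  split_ifs <;> first | rfl | lia

set_option maxHeartbeats 2000000 in
lemma lt_xPerm {n q j : ℕ} (hn : 8 ≤ n) (h1 : 1 ≤ j) (h5 : j + 5 ≤ n)
    (hr : j ≤ n % 3 ∨ j % 3 = n % 3) : j < xPerm n q j := by
  unfold xPerm
  split_ifs <;> omega

/-- The label `i` is in a 3-cycle of consecutive labels, whose top is congruent to `n` mod 3. As `i`
is not the top, one of the other two members exceeds it. -/
lemma lt_or_lt_of_eq_yPerm {n i j k : ℕ} (hk : 1 ≤ k) (h : n % 3 < i)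
    (hr : i % 3 ≠ n % 3) (hij : i = yPerm n j) (hjk : j = yPerm n k) : i < j ∨ i < k := by
  unfold yPerm at hij hjk
  split_ifs at hij hjk <;> omega

/-- A set of labels that contains the last five, and whose complement is closed under preimages
by `x` and `y`, consists of all the labels. -/
lemma eq_univ_of_invariant {n q : ℕ} (hn : 8 ≤ n) {B : Set (Fin n)}
    (hB : ∀ i : Fin n, n ≤ i.val + 5 → i ∈ B)
    (hx : ∀ i ∉ B, ∃ j ∉ B, i.val + 1 = xPerm n q (j + 1))
    (hy : ∀ i ∉ B, ∃ j ∉ B, i.val + 1 = yPerm n (j + 1)) : B = Set.univ := by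
  by_contra hne
  obtain ⟨i₀, hi₀⟩ : Bᶜ.Nonempty := by
    rw [Set.nonempty_compl]; exact hne
  obtain ⟨i, hi, hmax⟩ := Set.Finite.exists_maximalFor (fun i : Fin n => i.val) Bᶜ (Set.toFinite _)
    ⟨i₀, hi₀⟩
  have hlt : ∀ j ∉ B, j.val + 5 < n ∧ j.val ≤ i.val := by
    intro j hj
    refine ⟨by by_contra h; exact hj (hB j (by lia)), ?_⟩
    by_contra h
    exact h (hmax hj (by simp; lia))
  obtain ⟨j, hj, hij⟩ := hx i hi
  obtain ⟨k, hk, hik⟩ := hy i hi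
  obtain ⟨l, hl, hkl⟩ := hy k hk
  have h1 := hlt i hi
  have h2 := hlt j hj
  have h3 := hlt k hk
  have h4 := hlt l hl
  -- Fixed points of `y` and tops of its 3-cycles are moved upwards by `x`; every other label has a
  -- larger one in its `y`-cycle.
  by_cases hr : i.val + 1 ≤ n % 3 ∨ (i.val + 1) % 3 = n % 3
  · have hji := congrArg (xPerm n q) hij
    rw [xPerm_xPerm hn (by lia) (by lia)] at hji
    have := lt_xPerm (q := q) hn (by lia) (by lia) hr
    lia
  · have := lt_or_lt_of_eq_yPerm (by lia) (by lia) (by lia) hik hkl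
    lia

end Main

end SUGen

theorem theorem5p1 {K : Type*} [Field K] (p f n l : ℕ) [Fact p.Prime] [CharP K p]
    (hf : 1 ≤ f) (hK : Nat.card K = (p ^ f) ^ 2) (hn : 8 ≤ n) (a ω : K)
    (ha : SUGen.Admissible p (p ^ f) a ω) (hl : 1 ≤ l) (hln : l + 4 ≤ n)
    (hS : SUGen.partialSU (iterateFrobenius K p f) (SUGen.formJ p (p ^ f) n a)
        (SUGen.tailSet n l) ≤ SUGen.groupH p (p ^ f) n a ω) :
    SUGen.groupH p (p ^ f) n a ω =
      SUGen.specialUnitary (iterateFrobenius K p f) (SUGen.formJ p (p ^ f) n a) := by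
  open SUGen in
  have hle := groupH_le hK hn ha
  refine le_antisymm hle ?_
  have hJ := isHermitianForm_formJ hK (show 2 ≤ n by lia) ha
  set σ := iterateFrobenius K p f
  set J := formJ p (p ^ f) n a
  set H := groupH p (p ^ f) n a ω with hH
  set D : Set (Fin n) := {i | i.val + 2 < n} with hD
  have hσ : ∃ t, σ t ≠ t := exists_iterateFrobenius_ne hf hK
  have hN : ∀ t, σ t = t → ∃ α, α * σ α = t := exists_norm_eq hf hK
  -- The five vectors are `e_m, e_k, e_l` for the insertion step and the last two, where the form is
  -- not diagonal.
  obtain ⟨B, ⟨hB, hB5⟩, hmax⟩ := Set.Finite.exists_maximal (α := Set (Fin n))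
    (s := {B | ContainsSU σ J H B ∧ ∀ i : Fin n, n ≤ i.val + 5 → i ∈ B}) (Set.toFinite _)
    ⟨(tailSet n l : Set (Fin n)), hJ.containsSU_of_partialSU_le (fun i hi => by
      simp only [tailSet, Finset.coe_filter, Set.mem_compl_iff, Set.mem_ofPred_eq] at hi
      simp only [hD, Set.mem_ofPred_eq]
      simp at hi
      lia) hS, fun i hi => by simp [tailSet]; lia⟩
  have hBD : Bᶜ ⊆ D := fun i hi => by
    by_contra h
    simp only [hD, Set.mem_ofPred_eq] at h
    exact hi (hB5 i (by lia))
  -- Only the last four are required of `C`, since `x` and `y` can send a vector outside `B` to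
  -- `e_{n-4}`; that vector is only needed in `B`, to correct determinants.
  have key : ∀ C : Set (Fin n), ContainsSU σ J H C → (∀ i : Fin n, n ≤ i.val + 4 → i ∈ C) →
      C ⊆ B := by
    intro C hC hC4 i hi
    have hins : ContainsSU σ J H (insert i B) := by
      refine hJ.containsSU_insert hσ hN hBD (k := ⟨n - 4, by lia⟩) (l := ⟨n - 3, by lia⟩)
        (m := ⟨n - 5, by lia⟩) (hB5 _ ?_) (hB5 _ ?_) (hB5 _ ?_) ?_ ?_ ?_ ?_ ?_ ?_ hB
        (hC.anti ?_)
      any_goals (simp [hD]; lia)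
      rintro j ((rfl | rfl | rfl) | hj)
      · exact hi
      · exact hC4 _ (by simp; lia)
      · exact hC4 _ (by simp; lia)
      · simp only [hD, Set.mem_compl_iff, Set.mem_ofPred_eq] at hj
        exact hC4 _ (by lia)
    exact hmax (y := insert i B) ⟨hins, fun j hj => Or.inr (hB5 j hj)⟩ (Set.subset_insert _ _)
      (Set.mem_insert _ _)
  have hlt : ∀ j ∉ B, j.val + 5 < n := fun j hj => by
    by_contra h; exact hj (hB5 j (by lia))
  let gx : GL (Fin n) K := GeneralLinearGroup.mkOfDetNeZero
    ((-1 : K) ^ n • xMat p (p ^ f) n a ω) (by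
      rw [det_smul, det_xMat hn ha]
      exact mul_ne_zero (pow_ne_zero _ (pow_ne_zero _ (by simp))) (pow_ne_zero _ (by simp)))
  let gy : GL (Fin n) K := GeneralLinearGroup.mkOfDetNeZero (yMat p (p ^ f) n a) (by
      rw [det_yMat hK hn ha]; exact one_ne_zero)
  have hgx : gx ∈ H := Subgroup.subset_closure (Or.inl rfl)
  have hgy : gy ∈ H := Subgroup.subset_closure (Or.inr rfl)
  have hx : ∀ i ∉ B, ∃ j ∉ B, i.val + 1 = xPerm n (p ^ f) (j + 1) := by
    intro i hi
    by_contra! hcon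
    -- The set is the complement of `x(Bᶜ)`, so its inclusion in `B` means `Bᶜ ⊆ x(Bᶜ)`.
    refine hi (key {i | ∀ j ∉ B, i.val + 1 ≠ xPerm n (p ^ f) (j + 1)} ?_ ?_ hcon)
    · refine hB.image hgx (hle hgx) fun j hj => ?_
      have hj5 := hlt j hj
      have hm := xPerm_mem (q := p ^ f) hn (show 1 ≤ j.val + 1 by lia) (by lia)
      have e : xPerm n (p ^ f) (j + 1) - 1 + 1 = xPerm n (p ^ f) (j + 1) := by lia
      refine ⟨⟨xPerm n (p ^ f) (j + 1) - 1, by lia⟩, fun h => h j hj e, (-1) ^ n, ?_⟩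
      change ((-1 : K) ^ n • xMat p (p ^ f) n a ω) *ᵥ _ = _
      rw [smul_mulVec, xMat, withTail_label_mulVec_single (i := ⟨_, _⟩) (by lia) hm e]
    · intro i hi j hj h
      have hj5 := hlt j hj
      have hm := xPerm_mem (q := p ^ f) hn (show 1 ≤ j.val + 1 by lia) (by lia)
      lia
  have hy : ∀ i ∉ B, ∃ j ∉ B, i.val + 1 = yPerm n (j + 1) := by
    intro i hi
    by_contra! hcon
    refine hi (key {i | ∀ j ∉ B, i.val + 1 ≠ yPerm n (j + 1)} ?_ ?_ hcon)
    · refine hB.image hgy (hle hgy) fun j hj => ?_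
      have hj5 := hlt j hj
      have hm := yPerm_mem (n := n) (show 1 ≤ j.val + 1 by lia) (by lia)
      have e : yPerm n (j + 1) - 1 + 1 = yPerm n (j + 1) := by lia
      refine ⟨⟨yPerm n (j + 1) - 1, by lia⟩, fun h => h j hj e, 1, ?_⟩
      rw [one_smul]
      exact withTail_label_mulVec_single (i := ⟨_, _⟩) (by lia) hm e
    · intro i hi j hj h
      have hj5 := hlt j hj
      unfold yPerm at h
      split_ifs at h <;> omega
  have huniv := eq_univ_of_invariant hn hB5 hx hy
  intro g hg
  exact hB g ⟨hg.1, fun i hi => absurd (huniv ▸ Set.mem_univ i) hi⟩ hg.2
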